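/- **Setting.** Let $d,M\ge 1$ be integers and let $X$ be a finite set. Denote by $\|A\|_1=\operatorname{Tr}\sqrt{A^\dagger A}$ the trace norm on $B(\mathbb C^d)$, and for a linear map $T$ of $B(\mathbb C^d)$ to itself put $\|T\|_{1\to1}=\sup_{Y\ne0}\|T(Y)\|_1/\|Y\|_1$. Call $T$ a GKSL generator if $e^{sT}$ is completely positive and trace-preserving for every $s\ge0$. Fix a time $t>0$, a density matrix $\rho$ on $\mathbb C^d$, and a POVM $\{E_x\}_{x\in X}$ on $\mathbb C^d$. For a linear map $\mathcal L$ of $B(\mathbb C^d)$ to itself and $\varphi:X\to[-1,1]$ put $$P_{\mathcal L}(x)=\operatorname{Tr}\bigl(E_x\,e^{t\mathcal L}(\rho)\bigr),\qquad P_{\mathcal L}[\varphi]=\sum_{x\in X}\varphi(x)P_{\mathcal L}(x).$$ Let $\mathcal L_{\rm ref}$ be a GKSL generator, let $G_1,\dots,G_M$ be linear maps of $B(\mathbb C^d)$ to itself with $\|G_j\|_{1\to1}\le C_G$ for all $j$, where $C_G>0$, let $\delta>0$, and put $$\mathcal L(\theta)=\mathcal L_{\rm ref}+\frac{\delta}{\sqrt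 M}\sum_{j=1}^M\theta_jG_j,\qquad \theta\in S^{M-1}=\{\theta\in\mathbb R^M:\|\theta\|_2=1\}.$$ Let $\Theta\subseteq S^{M-1}$ be a set such that $\mathcal L(\theta)$ is a GKSL generator for every $\theta\in\Theta$ (for instance $\Theta=S^{M-1}$, if $\mathcal L(\theta)$ is a GKSL generator for all $\theta$), and put $F_\varphi(\theta)=P_{\mathcal L(\theta)}[\varphi]$ and $L_0=t\,\delta\,C_G$. Let $\mu_S$ be the uniform probability measure on $S^{M-1}$. Say that $c>0$ is a *Lévy constant* for $S^{M-1}$ if for every $K>0$, every $K$-Lipschitz $f:S^{M-1}\to\mathbb R$ (for the distance $\|\theta-\theta'\|_2$) and every $\tau>0$, $$\mu_S\bigl(|f-\mathbb E_{\mu_S}f|\ge\tau\bigr)\le2\exp\bigl(-c\,M\tau^2/K^2\bigr).$$ **Theorem.** There is an absolute constant $c>0$ that is a Lévy constant for $S^{M-1}$ for every $M\ge1$, and such that, for all data as above: 1. For every $\varphi:X\to[-1,1]$ and all $\theta,\theta'\in\Theta$, $\ |F_\varphi(\theta)-F_\varphi(\theta')|\le L_0\,\|\theta-\theta'\|_2$.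 2. Suppose that $\Theta$ has full measure, $\mu_S(S^{M-1}\setminus\Theta)=0$. Let $\mu_\Theta$ be the normalized restriction of $\mu_S$ to $\Theta$ and let $\mu_{\mathcal L}$ be the law of $\mathcal L(\theta)$ for $\theta\sim\mu_\Theta$. Then $\mu_{\mathcal L}$ is a probability measure; for every $\varphi:X\to[-1,1]$ the function $\mathcal L\mapsto P_{\mathcal L}[\varphi]$ is $\mu_{\mathcal L}$-integrable, and $Q[\varphi]:=\mathbb E_{\mathcal L\sim\mu_{\mathcal L}}P_{\mathcal L}[\varphi]=\mathbb E_{\theta\sim\mu_\Theta}F_\varphi(\theta)$; and for every $\tau>0$, $$\operatorname{frac}(\mu_{\mathcal L},Q,\tau):=\sup_{\varphi:X\to[-1,1]}\Pr_{\mathcal L\sim\mu_{\mathcal L}}\bigl(|P_{\mathcal L}[\varphi]-Q[\varphi]|\ge\tau\bigr)\le2\exp\Bigl(-c\,\frac{M\tau^2}{L_0^2}\Bigr).$$ Moreover, the last bound holds with $c$ replaced by any Lévy constant $c'>0$ for $S^{M-1}$. -/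

import Mathlib

open MeasureTheory
open scoped ENNReal NNReal ComplexOrder

noncomputable section

namespace OpenSQ

/-! Superoperators on the matrix algebra of a `d`-dimensional Hilbert space. -/

/-- Superoperators: linear maps of `B(ℂ^d)`, the complex `d × d` matrices, to itself. -/
abbrev Superop (d : ℕ) : Type := Module.End ℂ (Matrix (Fin d) (Fin d) ℂ)

/-- The trace norm `‖A‖₁`, the sum of the singular values of `A`, that is, of the square roots
of the eigenvalues of `A† A`. -/
def traceNorm {d : ℕ} (A : Matrix (Fin d) (Fin d) ℂ) : ℝ :=
  ∑ i, √((Matrix.isHermitian_conjTranspose_mul_self A).eigenvalues i)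

/-- The induced norm `‖T‖_{1→1} = sup_{X ≠ 0} ‖T X‖₁ / ‖X‖₁`, as a supremum in `[0, ∞]`
(it is finite, the dimension being finite). -/
def inducedNorm {d : ℕ} (T : Superop d) : ℝ≥0∞ :=
  ⨆ (X : Matrix (Fin d) (Fin d) ℂ) (_ : X ≠ 0), ENNReal.ofReal (traceNorm (T X) / traceNorm X)

/-- The isomorphism of algebras between superoperators and `d² × d²` matrices given by the basis
of matrix units. It is used only to carry over the topology: every isomorphism gives the same. -/
def superMatrix (d : ℕ) :
    Superop d ≃ₐ[ℂ] Matrix (Fin d × Fin d) (Fin d × Fin d) ℂ :=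
  LinearMap.toMatrixAlgEquiv (Matrix.stdBasis ℂ (Fin d) (Fin d))

/-- The exponential of a superoperator. -/
def superExp {d : ℕ} (T : Superop d) : Superop d :=
  (superMatrix d).symm (NormedSpace.exp (superMatrix d T))

/-- The Borel σ-algebra on the finite-dimensional space of superoperators. -/
instance superopMeasurableSpace (d : ℕ) : MeasurableSpace (Superop d) :=
  MeasurableSpace.comap (superMatrix d) (borel (Matrix (Fin d × Fin d) (Fin d × Fin d) ℂ))

/-- `id_k ⊗ T`: the superoperator `T` applied to every block of a `k × k` block matrix. -/
def ampliation {d : ℕ} (k : ℕ) (T : Superop d)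
    (A : Matrix (Fin k × Fin d) (Fin k × Fin d) ℂ) :
    Matrix (Fin k × Fin d) (Fin k × Fin d) ℂ :=
  Matrix.of fun p q => T (Matrix.of fun a b => A (p.1, a) (q.1, b)) p.2 q.2

/-- Completely positive and trace-preserving superoperators. -/
structure IsCPTP {d : ℕ} (T : Superop d) : Prop where
  completelyPositive : ∀ (k : ℕ) (A : Matrix (Fin k × Fin d) (Fin k × Fin d) ℂ),
    A.PosSemidef → (ampliation k T A).PosSemidef
  tracePreserving : ∀ X : Matrix (Fin d) (Fin d) ℂ, (T X).trace = X.trace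

/-- GKSL generators (Lindbladians): the generators of quantum Markov semigroups, i.e. the
superoperators `L` such that `e^{tL}` is CPTP for all `t ≥ 0`. (Such an `L` automatically
preserves Hermiticity and has traceless values.) -/
def IsGKSL {d : ℕ} (L : Superop d) : Prop :=
  ∀ t : ℝ, 0 ≤ t → IsCPTP (superExp (t • L))

/-! The statistical-query interface. -/

/-- Density matrices. -/
structure IsState {d : ℕ} (ρ : Matrix (Fin d) (Fin d) ℂ) : Prop where
  posSemidef : ρ.PosSemidef
  trace_eq_one : ρ.trace = 1

/-- POVMs with outcomes in the finite set `X`. -/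
structure IsPOVM {d : ℕ} {X : Type*} [Fintype X] (E : X → Matrix (Fin d) (Fin d) ℂ) : Prop where
  posSemidef : ∀ x, (E x).PosSemidef
  sum_eq_one : ∑ x, E x = 1

/-- `P_L(x) = Tr(E_x e^{tL}(ρ))`, a real number if `L` is a Lindbladian, `ρ` is a state,
`E` is a POVM and `t ≥ 0`. -/
def outputProb {d : ℕ} {X : Type*} (t : ℝ) (ρ : Matrix (Fin d) (Fin d) ℂ)
    (E : X → Matrix (Fin d) (Fin d) ℂ) (L : Superop d) (x : X) : ℝ :=
  ((E x * superExp (t • L) ρ).trace).re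

/-- Test functions `φ : X → [-1, 1]`. -/
abbrev TestFn (X : Type*) : Type _ := X → Set.Icc (-1 : ℝ) 1

/-- The statistical query expectation `P_L[φ] = ∑ x, φ(x) P_L(x)`. -/
def queryExp {d : ℕ} {X : Type*} [Fintype X] (t : ℝ) (ρ : Matrix (Fin d) (Fin d) ℂ)
    (E : X → Matrix (Fin d) (Fin d) ℂ) (φ : TestFn X) (L : Superop d) : ℝ :=
  ∑ x, (φ x : ℝ) * outputProb t ρ E L x

/-- The ensemble average `Q[φ] = E_{L ∼ μ} P_L[φ]`. -/
def meanQuery {d : ℕ} {X : Type*} [Fintype X] (t : ℝ) (ρ : Matrix (Fin d) (Fin d) ℂ)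
    (E : X → Matrix (Fin d) (Fin d) ℂ) (μ : Measure (Superop d)) (φ : TestFn X) : ℝ :=
  ∫ L, queryExp t ρ E φ L ∂μ

/-- The maximally distinguishable fraction
`frac(μ, Q, τ) = sup_φ Pr_{L ∼ μ} (|P_L[φ] - Q[φ]| ≥ τ)`, over all `φ : X → [-1, 1]`. -/
def frac {d : ℕ} {X : Type*} [Fintype X] (t : ℝ) (ρ : Matrix (Fin d) (Fin d) ℂ)
    (E : X → Matrix (Fin d) (Fin d) ℂ) (μ : Measure (Superop d)) (Q : TestFn X → ℝ) (τ : ℝ) :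
    ℝ≥0∞ :=
  ⨆ φ : TestFn X, μ {L | τ ≤ |queryExp t ρ E φ L - Q φ|}

/-! The spherical ensemble. -/

/-- The unit sphere `S^{M-1}` of the Euclidean space `ℝ^M`. -/
abbrev ParamSphere (M : ℕ) : Set (EuclideanSpace ℝ (Fin M)) := Metric.sphere 0 1

/-- The uniform (rotation-invariant) probability measure on `S^{M-1}`: the normalized surface
measure. -/
def sphereUniform (M : ℕ) : Measure (ParamSphere M) :=
  let σ : Measure (ParamSphere M) := (volume : Measure (EuclideanSpace ℝ (Fin M))).toSphere
  (σ Set.univ)⁻¹ • σ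

/-- `L(θ) = L_ref + (δ / √M) ∑ j, θ_j G_j`. -/
def lindbladFamily {d M : ℕ} (Lref : Superop d) (G : Fin M → Superop d) (δ : ℝ)
    (θ : ParamSphere M) : Superop d :=
  Lref + (δ / √(M : ℝ)) • ∑ j, (θ : EuclideanSpace ℝ (Fin M)) j • G j

/-- The parameter measure `μ_Θ`: the restriction of the uniform measure to `Θ`, normalized. -/
def paramMeasure {M : ℕ} (Θ : Set (ParamSphere M)) : Measure (ParamSphere M) :=
  (sphereUniform M Θ)⁻¹ • (sphereUniform M).restrict Θ

/-- The random Lindbladian ensemble `μ_L`: the law of `L(θ)` for `θ ∼ μ_Θ`. -/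
def lindbladEnsemble {d M : ℕ} (Lref : Superop d) (G : Fin M → Superop d) (δ : ℝ)
    (Θ : Set (ParamSphere M)) : Measure (Superop d) :=
  (paramMeasure Θ).map (lindbladFamily Lref G δ)

/-- `c` is a constant in Lévy's concentration inequality on `S^{M-1}`: every `K`-Lipschitz `f`
has `Pr(|f - E f| ≥ τ) ≤ 2 exp(-c M τ² / K²)` for all `τ > 0`. -/
def IsLevyConstant (M : ℕ) (c : ℝ) : Prop :=
  ∀ (K : ℝ≥0) (f : ParamSphere M → ℝ), 0 < K → LipschitzWith K f → ∀ τ : ℝ, 0 < τ →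
    sphereUniform M {θ | τ ≤ |f θ - ∫ θ', f θ' ∂(sphereUniform M)|} ≤
      ENNReal.ofReal (2 * Real.exp (-(c * (M * τ ^ 2 / (K : ℝ) ^ 2))))

end OpenSQ

end

open OpenSQ

/-! A query expectation is a Lipschitz function of the parameter on the sphere, with a constant free
of the dimension, so concentration of measure forces it close to its mean for most parameters.

Lipschitz bound. By Duhamel, `e^{tL} - e^{tL'}` is the integral over `s` in `[0, t]` of `e^{(t-s)L'}
(L - L') e^{sL}`. Applied to `ρ`, the right factor yields a state; the left factor, moved onto the
observable `B = ∑ φ(x) E_x` in the Heisenberg picture, keeps it between `-1` and `1`. Each `G j`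
thus contributes at most `C_G`, and `‖v‖₁ ≤ √M ‖v‖₂` is cancelled by the normalization `δ / √M`. The
interpolation runs in time between two fixed generators and never through other parameters, so `Θ`
may be any set (`abs_queryExp_lindbladFamily_sub_le`).

Lévy's inequality is derived from Gaussian concentration. The Maurey–Pisier rotation argument
(`integral_exp_sub_stdGaussian_le`) shows that Lipschitz functions of a Gaussian vector are
sub-Gaussian. A centred `f` on the sphere extends to the homogeneous function `r θ ↦ r f(θ)`, which
is Lipschitz on the whole space. In polar coordinates `r` is independent of `θ` and has mean at
least of order `√M`; Jensen's inequality in `r` returns the estimate to `f` with the factor `M`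
gained (`hasSubgaussianMGF_sphere`).

For a full-measure `Θ`, a Lipschitz extension from `Θ` changes the query function only on a null
set, so Lévy's inequality still applies. -/

open OpenSQ

/-! ### Density and exponential moments of the standard Gaussian measure. -/

section Gaussian

open ProbabilityTheory Filter Topology

variable {E : Type*} [NormedAddCommGroup E] [InnerProductSpace ℝ E]

/-- The density of the standard Gaussian measure with respect to the volume. -/
noncomputable def stdGaussianPDF (E : Type*) [NormedAddCommGroup E] [InnerProductSpace ℝ E]
    (x : E) : ℝ :=
  ((2 * Real.pi) ^ ((Module.finrank ℝ E : ℝ) / 2))⁻¹ * Real.exp (-(‖x‖ ^ 2 / 2))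

lemma stdGaussianPDF_pos (x : E) : 0 < stdGaussianPDF E x := by
  unfold stdGaussianPDF; positivity

lemma continuous_stdGaussianPDF : Continuous (stdGaussianPDF E) := by
  unfold stdGaussianPDF; fun_prop

variable [FiniteDimensional ℝ E] [MeasurableSpace E] [BorelSpace E]

/-- This is the characteristic function of the density: `t = 0` gives its normalization, and
uniqueness identifies the measure. -/
lemma integral_cexp_inner_mul_stdGaussianPDF (t : E) :
    ∫ x, stdGaussianPDF E x • Complex.exp (inner ℝ x t * Complex.I) =
      Complex.exp (-‖t‖ ^ 2 / 2) := by
  have h := GaussianFourier.integral_cexp_neg_mul_sq_norm_add (V := E) (b := 1 / 2) (by norm_num)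
    Complex.I t
  set C : ℝ := (2 * Real.pi) ^ ((Module.finrank ℝ E : ℝ) / 2) with hC
  have hC0 : C ≠ 0 := by positivity
  have h1 : (fun x : E => stdGaussianPDF E x • Complex.exp (inner ℝ x t * Complex.I)) =
      fun x : E => (C : ℂ)⁻¹ *
        Complex.exp (-(1 / 2) * (‖x‖ : ℂ) ^ 2 + Complex.I * (inner ℝ t x : ℝ)) := by
    funext x
    rw [Complex.exp_add, stdGaussianPDF, ← hC, Complex.real_smul, real_inner_comm]
    push_cast
    rw [mul_assoc]
    congr 2
    · congr 1; ring
    · congr 1; ring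
  rw [h1, integral_const_mul, h]
  have h2 : ((Real.pi : ℂ) / (1 / 2)) ^ ((Module.finrank ℝ E : ℂ) / 2) = (C : ℂ) := by
    rw [hC, Complex.ofReal_cpow (by positivity)]
    push_cast
    congr 1; ring
  rw [h2, ← mul_assoc, inv_mul_cancel₀ (by exact_mod_cast hC0), one_mul]
  congr 1
  rw [Complex.I_sq]; ring

lemma integral_stdGaussianPDF : ∫ x, stdGaussianPDF E x = 1 := by
  have h := integral_cexp_inner_mul_stdGaussianPDF (0 : E)
  simp only [inner_zero_right, Complex.ofReal_zero, zero_mul, Complex.exp_zero, norm_zero] at h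
  have h2 : ∫ x, ((stdGaussianPDF E x : ℝ) : ℂ) = 1 := by
    simpa using h
  rw [integral_complex_ofReal] at h2
  exact_mod_cast h2

lemma stdGaussian_eq_withDensity :
    stdGaussian E = volume.withDensity (fun x => ENNReal.ofReal (stdGaussianPDF E x)) := by
  -- A non-integrable function would have integral `0` by convention, not `1`.
  have hint : Integrable (stdGaussianPDF E) := by
    by_contra h
    simpa [integral_undef h] using integral_stdGaussianPDF (E := E)
  have : IsFiniteMeasure (volume.withDensity fun x => ENNReal.ofReal (stdGaussianPDF E x)) :=
    isFiniteMeasure_withDensity_ofReal hint.2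
  refine Measure.ext_of_charFun ?_
  ext t
  rw [charFun_stdGaussian, charFun_apply, integral_withDensity_eq_integral_toReal_smul
    (continuous_stdGaussianPDF.measurable.ennreal_ofReal) (by simp),
    ← integral_cexp_inner_mul_stdGaussianPDF]
  refine integral_congr_ae (.of_forall fun x => ?_)
  simp only [ENNReal.toReal_ofReal (stdGaussianPDF_pos x).le]

/-- Fernique's theorem makes `exp (C ‖x‖²)` integrable for some `C > 0`, and completing the square
gives `a ‖x‖ ≤ C ‖x‖² + a² / (4C)`. -/
lemma integrable_exp_mul_norm_stdGaussian (a : ℝ) :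
    Integrable (fun x : E => Real.exp (a * ‖x‖)) (stdGaussian E) := by
  obtain ⟨C, hC, hi⟩ := IsGaussian.exists_integrable_exp_sq (stdGaussian E)
  refine (hi.const_mul (Real.exp (a ^ 2 / (4 * C)))).mono' (by fun_prop) (.of_forall fun x => ?_)
  rw [Real.norm_eq_abs, Real.abs_exp, ← Real.exp_add, Real.exp_le_exp]
  have : a ^ 2 / (4 * C) + C * ‖x‖ ^ 2 - a * ‖x‖ = (a - 2 * C * ‖x‖) ^ 2 / (4 * C) := by
    field_simp; ring
  have h2 : 0 ≤ (a - 2 * C * ‖x‖) ^ 2 / (4 * C) := by positivity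
  linarith

/-- The law of `l` is the centred Gaussian of variance `‖l‖²`. This integrates out the second vector
in the Maurey–Pisier argument. -/
lemma integral_exp_dual_stdGaussian (l : StrongDual ℝ E) (s : ℝ) :
    ∫ y, Real.exp (s * l y) ∂(stdGaussian E) = Real.exp (s ^ 2 * ‖l‖ ^ 2 / 2) := by
  have h := IsGaussian.map_eq_gaussianReal (μ := stdGaussian E) l
  rw [integral_strongDual_stdGaussian, variance_dual_stdGaussian] at h
  have h2 := mgf_gaussianReal h s
  rw [mgf] at h2
  rw [h2, Real.coe_toNNReal _ (by positivity)]
  congr 1; ring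

end Gaussian

/-! ### Gaussian concentration by the Maurey–Pisier rotation argument. -/

section MaureyPisier

open ProbabilityTheory Filter Topology

variable {E : Type*} [NormedAddCommGroup E] [InnerProductSpace ℝ E]

lemma abs_sub_rotate_le {F : E → ℝ} {L : ℝ≥0} (hF : LipschitzWith L F) (h : ℝ) (x y : E) :
    |F x - F (Real.cos h • x + Real.sin h • y)| ≤ L * |h| * (‖x‖ + ‖y‖) := by
  have h1 := hF.dist_le_mul x (Real.cos h • x + Real.sin h • y)
  rw [Real.dist_eq, dist_eq_norm] at h1
  refine h1.trans ?_
  rw [mul_assoc]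
  gcongr
  have e : x - (Real.cos h • x + Real.sin h • y) =
      (Real.cos 0 - Real.cos h) • x + (Real.sin 0 - Real.sin h) • y := by
    simp [sub_smul]; abel
  rw [e]
  refine (norm_add_le _ _).trans ?_
  rw [norm_smul, norm_smul, Real.norm_eq_abs, Real.norm_eq_abs, mul_add]
  have hc := Real.abs_cos_sub_cos_le 0 h
  have hs := Real.abs_sin_sub_sin_le 0 h
  rw [zero_sub, abs_neg] at hc hs
  gcongr

/-- With `s * N` for `s` and `h = π / (2N)` the bound no longer depends on `N`, so it serves as the
majorant for dominated convergence. -/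
lemma exp_mul_sub_rotate_le {F : E → ℝ} {L : ℝ≥0} (hF : LipschitzWith L F) (s h : ℝ) (x y : E) :
    Real.exp (s * (F x - F (Real.cos h • x + Real.sin h • y))) ≤
      Real.exp (|s| * (L * |h|) * (‖x‖ + ‖y‖)) := by
  rw [Real.exp_le_exp]
  refine (le_abs_self _).trans ?_
  rw [abs_mul, mul_assoc]
  gcongr
  exact abs_sub_rotate_le hF h x y

/-- The curve `cos h • x + sin h • y` leaves `x` with velocity `y`, and `N` is `π / 2` divided by
the step. -/
lemma tendsto_mul_sub_rotate {F : E → ℝ} {x : E} (hx : DifferentiableAt ℝ F x) (y : E) :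
    Tendsto (fun N : ℕ => (N : ℝ) * (F x - F (Real.cos (Real.pi / 2 / N) • x +
      Real.sin (Real.pi / 2 / N) • y))) atTop (𝓝 (-(Real.pi / 2) * fderiv ℝ F x y)) := by
  have hz : HasDerivAt (fun h : ℝ => Real.cos h • x + Real.sin h • y) y 0 := by
    have := ((Real.hasDerivAt_cos 0).smul_const x).add ((Real.hasDerivAt_sin 0).smul_const y)
    simp only [Real.sin_zero, neg_zero, zero_smul, Real.cos_zero, one_smul, zero_add] at this
    exact this
  have hF : HasFDerivAt F (fderiv ℝ F x) (Real.cos (0 : ℝ) • x + Real.sin (0 : ℝ) • y) := by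
    simpa using hx.hasFDerivAt
  have hd := hF.comp_hasDerivAt (0 : ℝ) hz
  have ht := hd.tendsto_slope_zero
  have hN : Tendsto (fun N : ℕ => Real.pi / 2 / (N : ℝ)) atTop (𝓝[≠] 0) := by
    rw [tendsto_nhdsWithin_iff]
    refine ⟨tendsto_const_div_atTop_nhds_zero_nat _, ?_⟩
    filter_upwards [eventually_ne_atTop 0] with N hN
    have : (N : ℝ) ≠ 0 := by exact_mod_cast hN
    simp [this, Real.pi_ne_zero]
  have h2 := (ht.comp hN).const_mul (-(Real.pi / 2))
  refine h2.congr' ?_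
  filter_upwards [eventually_ne_atTop 0] with N hN
  have : (N : ℝ) ≠ 0 := by exact_mod_cast hN
  have hpi := Real.pi_ne_zero
  simp only [Function.comp_apply, smul_eq_mul, zero_add, Real.cos_zero, Real.sin_zero, one_smul,
    zero_smul, add_zero]
  field_simp
  ring

variable [FiniteDimensional ℝ E] [MeasurableSpace E] [BorelSpace E]

lemma integrable_exp_norm_add_norm_stdGaussian (a : ℝ) :
    Integrable (fun p : E × E => Real.exp (a * (‖p.1‖ + ‖p.2‖)))
      ((stdGaussian E).prod (stdGaussian E)) := by
  have := (integrable_exp_mul_norm_stdGaussian (E := E) a).mul_prod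
    (integrable_exp_mul_norm_stdGaussian (E := E) a)
  simpa only [mul_add, Real.exp_add] using this

lemma integrable_exp_mul_sub_rotate {F : E → ℝ} {L : ℝ≥0} (hF : LipschitzWith L F) (s h : ℝ) :
    Integrable (fun p : E × E =>
      Real.exp (s * (F p.1 - F (Real.cos h • p.1 + Real.sin h • p.2))))
      ((stdGaussian E).prod (stdGaussian E)) := by
  have hc := hF.continuous
  refine (integrable_exp_norm_add_norm_stdGaussian (E := E) (|s| * (L * |h|))).mono'
    (Continuous.aestronglyMeasurable (by fun_prop)) (.of_forall fun p => ?_)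
  rw [Real.norm_eq_abs, Real.abs_exp]
  exact exp_mul_sub_rotate_le hF s h p.1 p.2

/-- The exponential moment of `F x - F y` is at most that of the increments of `F`
along a division of the quarter turn from `x` to `y` into `N` equal rotations. -/
lemma integral_exp_sub_le_integral_rotate {F : E → ℝ} {L : ℝ≥0} (hF : LipschitzWith L F) (s : ℝ)
    {N : ℕ} (hN : N ≠ 0) :
    ∫ p : E × E, Real.exp (s * (F p.1 - F p.2)) ∂((stdGaussian E).prod (stdGaussian E)) ≤
    ∫ p : E × E, Real.exp (s * N * (F p.1 - F (Real.cos (Real.pi / 2 / N) • p.1 +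
      Real.sin (Real.pi / 2 / N) • p.2))) ∂((stdGaussian E).prod (stdGaussian E)) := by
  set γ := (stdGaussian E).prod (stdGaussian E) with hγ
  set h : ℝ := Real.pi / 2 / N with hh
  have hN' : (N : ℝ) ≠ 0 := by exact_mod_cast hN
  let Z : ℕ → E × E → E := fun k p => Real.cos (k * h) • p.1 + Real.sin (k * h) • p.2
  set g : E × E → ℝ := fun p =>
    Real.exp (s * N * (F p.1 - F (Real.cos h • p.1 + Real.sin h • p.2))) with hg
  have hgi : Integrable g γ := integrable_exp_mul_sub_rotate hF (s * N) h
  have hrot : ∀ θ : ℝ, MeasurePreserving (ContinuousLinearMap.rotation (E := E) θ) γ γ := fun θ =>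
    ⟨(ContinuousLinearMap.continuous _).measurable,
      IsGaussian.map_rotation_eq_self integral_id_stdGaussian θ⟩
  -- Rotating the pair by `k * h` turns the first increment into the `k`-th one; by rotation
  -- invariance of `γ` all increments then have the same exponential moment.
  have hgk : ∀ (k : ℕ) (p : E × E), g (ContinuousLinearMap.rotation (k * h) p) =
      Real.exp (s * N * (F (Z k p) - F (Z (k + 1) p))) := by
    intro k p
    simp only [hg, ContinuousLinearMap.rotation_apply, Z]
    congr 4
    push_cast
    rw [add_mul, one_mul, Real.cos_add, Real.sin_add]
    module
  have hint : ∀ k : ℕ, Integrable (fun p => Real.exp (s * N * (F (Z k p) - F (Z (k + 1) p)))) γ := by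
    intro k
    have := (hrot (k * h)).integrable_comp_of_integrable hgi
    refine this.congr (.of_forall fun p => ?_)
    exact hgk k p
  have hval : ∀ k : ℕ, ∫ p, Real.exp (s * N * (F (Z k p) - F (Z (k + 1) p))) ∂γ = ∫ p, g p ∂γ := by
    intro k
    simp_rw [← hgk]
    have h1 := (hrot (k * h)).map_eq
    conv_rhs => rw [← h1]
    rw [integral_map (hrot _).measurable.aemeasurable]
    rw [h1]; exact hgi.1
  have hpt : ∀ p : E × E, Real.exp (s * (F p.1 - F p.2)) ≤
      ∑ k ∈ Finset.range N, (N : ℝ)⁻¹ * Real.exp (s * N * (F (Z k p) - F (Z (k + 1) p))) := by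
    intro p
    -- Jensen with equal weights: the telescoping difference `F x - F y` is the average of `N` times
    -- the increments.
    have hconv := convexOn_exp.map_sum_le (t := Finset.range N) (w := fun _ => (N : ℝ)⁻¹)
      (p := fun k => s * N * (F (Z k p) - F (Z (k + 1) p))) (by intros; positivity)
      (by simp [hN']) (by simp)
    simp only [smul_eq_mul] at hconv
    refine le_trans (le_of_eq ?_) hconv
    congr 1
    have e : ∀ k, (N : ℝ)⁻¹ * (s * N * (F (Z k p) - F (Z (k + 1) p))) =
        s * (F (Z k p) - F (Z (k + 1) p)) := by intro k; field_simp
    simp_rw [e]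
    rw [← Finset.mul_sum, Finset.sum_range_sub']
    have e0 : Z 0 p = p.1 := by simp [Z]
    have e1 : Z N p = p.2 := by
      have : (N : ℝ) * h = Real.pi / 2 := by rw [hh]; field_simp
      simp [Z, this]
    rw [e0, e1]
  calc _ ≤ ∫ p, ∑ k ∈ Finset.range N,
        (N : ℝ)⁻¹ * Real.exp (s * N * (F (Z k p) - F (Z (k + 1) p))) ∂γ := by
        refine integral_mono_of_nonneg (.of_forall fun p => (Real.exp_pos _).le)
          (integrable_finsetSum _ fun k _ => (hint k).const_mul _) (.of_forall hpt)
    _ = ∫ p, g p ∂γ := by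
        rw [integral_finsetSum _ fun k _ => (hint k).const_mul _]
        simp_rw [integral_const_mul, hval]
        simp [hN']

/-- The Maurey–Pisier inequality for Lipschitz functions of two independent Gaussian vectors. -/
theorem integral_exp_sub_stdGaussian_le {F : E → ℝ} {L : ℝ≥0} (hF : LipschitzWith L F) (s : ℝ) :
    ∫ p : E × E, Real.exp (s * (F p.1 - F p.2)) ∂((stdGaussian E).prod (stdGaussian E)) ≤
      Real.exp (s ^ 2 * (Real.pi / 2) ^ 2 * L ^ 2 / 2) := by
  set γ := (stdGaussian E).prod (stdGaussian E) with hγ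
  have hac : stdGaussian E ≪ volume := by
    rw [stdGaussian_eq_withDensity]; exact withDensity_absolutelyContinuous _ _
  -- Rademacher's theorem. Every increment has been rotated back to start at `p.1`, so
  -- differentiability there is enough and no smoothing of `F` is needed.
  have hdiff : ∀ᵐ p ∂γ, DifferentiableAt ℝ F p.1 :=
    Measure.quasiMeasurePreserving_fst.ae (hac.ae_le hF.ae_differentiableAt)
  have hlim : Tendsto (fun N : ℕ => ∫ p : E × E, Real.exp (s * N * (F p.1 -
      F (Real.cos (Real.pi / 2 / N) • p.1 + Real.sin (Real.pi / 2 / N) • p.2))) ∂γ) atTop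
      (𝓝 (∫ p : E × E, Real.exp (s * (-(Real.pi / 2)) * fderiv ℝ F p.1 p.2) ∂γ)) := by
    refine tendsto_integral_filter_of_dominated_convergence
      (fun p => Real.exp (|s| * (L * (Real.pi / 2)) * (‖p.1‖ + ‖p.2‖)))
      (.of_forall fun N => (integrable_exp_mul_sub_rotate hF _ _).1) ?_
      (integrable_exp_norm_add_norm_stdGaussian _) ?_
    · filter_upwards [eventually_ne_atTop 0] with N hN
      refine .of_forall fun p => ?_
      rw [Real.norm_eq_abs, Real.abs_exp]
      refine (exp_mul_sub_rotate_le hF _ _ _ _).trans (le_of_eq ?_)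
      have : (N : ℝ) ≠ 0 := by exact_mod_cast hN
      have hpi := Real.pi_pos
      congr 2
      rw [abs_mul, abs_div, Nat.abs_cast, abs_of_pos (by positivity : 0 < Real.pi / 2)]
      field_simp
    · filter_upwards [hdiff] with p hp
      refine (Real.continuous_exp.tendsto _).comp ?_
      have := (tendsto_mul_sub_rotate hp p.2).const_mul s
      simpa only [mul_assoc] using this
  refine (ge_of_tendsto hlim ?_).trans ?_
  · filter_upwards [eventually_ne_atTop 0] with N hN
    exact integral_exp_sub_le_integral_rotate hF s hN
  -- Given `x`, the exponent is linear in the Gaussian vector `y`, with norm controlled by `‖fderiv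
  -- ℝ F x‖ ≤ L`. Without integrability the integral is `0` by convention and the bound is trivial.
  · by_cases hi : Integrable (fun p : E × E =>
      Real.exp (s * (-(Real.pi / 2)) * fderiv ℝ F p.1 p.2)) γ
    · rw [integral_prod _ hi]
      simp_rw [integral_exp_dual_stdGaussian]
      calc _ ≤ ∫ _ : E, Real.exp (s ^ 2 * (Real.pi / 2) ^ 2 * L ^ 2 / 2) ∂(stdGaussian E) := by
            refine integral_mono_of_nonneg (.of_forall fun p => (Real.exp_pos _).le)
              (integrable_const _) (.of_forall fun x => ?_)
            simp only [Real.exp_le_exp]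
            have := norm_fderiv_le_of_lipschitz ℝ (x₀ := x) hF
            rw [mul_pow, neg_sq]
            gcongr
        _ = _ := by simp
    · rw [integral_undef hi]; positivity

lemma integrable_exp_mul_lipschitz_stdGaussian {F : E → ℝ} {L : ℝ≥0} (hF : LipschitzWith L F)
    (s : ℝ) : Integrable (fun x => Real.exp (s * F x)) (stdGaussian E) := by
  have hc := hF.continuous
  refine ((integrable_exp_mul_norm_stdGaussian (E := E) (|s| * L)).const_mul
    (Real.exp (|s| * |F 0|))).mono' (Continuous.aestronglyMeasurable (by fun_prop))
    (.of_forall fun x => ?_)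
  rw [Real.norm_eq_abs, Real.abs_exp, ← Real.exp_add, Real.exp_le_exp]
  have h1 := hF.dist_le_mul x 0
  rw [Real.dist_eq, dist_zero_right] at h1
  have h2 : |F x| ≤ |F 0| + L * ‖x‖ := by
    have := abs_add_le (F x - F 0) (F 0)
    rw [sub_add_cancel] at this
    linarith
  calc s * F x ≤ |s| * |F x| := by rw [← abs_mul]; exact le_abs_self _
    _ ≤ |s| * (|F 0| + L * ‖x‖) := by gcongr
    _ = _ := by ring

lemma integrable_lipschitz_stdGaussian {F : E → ℝ} {L : ℝ≥0} (hF : LipschitzWith L F) :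
    Integrable F (stdGaussian E) := by
  have hc := hF.continuous
  refine ((integrable_exp_mul_lipschitz_stdGaussian hF 1).add
    (integrable_exp_mul_lipschitz_stdGaussian hF (-1))).mono'
    hc.aestronglyMeasurable (.of_forall fun x => ?_)
  rw [Real.norm_eq_abs, Pi.add_apply, one_mul, neg_one_mul]
  have h1 := Real.add_one_le_exp (F x)
  have h2 := Real.add_one_le_exp (-F x)
  have h3 := Real.exp_pos (F x)
  have h4 := Real.exp_pos (-F x)
  rw [abs_le]; constructor <;> linarith

/-- Gaussian concentration: a centred Lipschitz function of a Gaussian vector is sub-Gaussian. -/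
theorem integral_exp_lipschitz_stdGaussian_le {F : E → ℝ} {L : ℝ≥0} (hF : LipschitzWith L F)
    (h0 : ∫ x, F x ∂(stdGaussian E) = 0) (s : ℝ) :
    ∫ x, Real.exp (s * F x) ∂(stdGaussian E) ≤
      Real.exp (s ^ 2 * (Real.pi / 2) ^ 2 * L ^ 2 / 2) := by
  have h := integral_exp_sub_stdGaussian_le hF s
  have e : ∀ p : E × E, Real.exp (s * (F p.1 - F p.2)) =
      Real.exp (s * F p.1) * Real.exp (-s * F p.2) := by
    intro p; rw [← Real.exp_add]; congr 1; ring
  simp_rw [e] at h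
  rw [integral_prod_mul (fun x => Real.exp (s * F x)) (fun y => Real.exp (-s * F y))] at h
  -- The exponential moment of the difference factors by independence; the second factor is at least
  -- `1`, by `1 + u ≤ exp u` and the zero mean, and can be dropped.
  have h1 : 1 ≤ ∫ y, Real.exp (-s * F y) ∂(stdGaussian E) := by
    have hFi := integrable_lipschitz_stdGaussian hF
    calc (1 : ℝ) = ∫ y, (-s * F y + 1) ∂(stdGaussian E) := by
          rw [integral_add (hFi.const_mul _) (integrable_const _), integral_const_mul, h0]
          simp
      _ ≤ _ := integral_mono ((hFi.const_mul _).add (integrable_const _))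
          (integrable_exp_mul_lipschitz_stdGaussian hF (-s)) fun y => Real.add_one_le_exp _
  refine le_trans ?_ h
  exact le_mul_of_one_le_right (integral_nonneg fun x => (Real.exp_pos _).le) h1

end MaureyPisier

/-! ### Lévy's inequality on the sphere from Gaussian concentration. -/

section Sphere

open ProbabilityTheory Filter Topology

lemma sphere_nontrivial {M : ℕ} (hM : 1 ≤ M) : Nontrivial (EuclideanSpace ℝ (Fin M)) := by
  have : Nonempty (Fin M) := ⟨⟨0, hM⟩⟩
  infer_instance

lemma isProbabilityMeasure_sphereUniform {M : ℕ} (hM : 1 ≤ M) :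
    IsProbabilityMeasure (sphereUniform M) := by
  have := sphere_nontrivial hM
  refine ⟨?_⟩
  simp only [sphereUniform, Measure.smul_apply, smul_eq_mul]
  refine ENNReal.inv_mul_cancel ?_ (measure_ne_top _ _)
  rw [Measure.measure_univ_ne_zero]
  exact Measure.toSphere_ne_zero _

/-- Polar coordinates for the standard Gaussian measure: the direction is uniform on the sphere
and independent of the norm. -/
lemma exists_measurePreserving_polar_stdGaussian {M : ℕ} (hM : 1 ≤ M) :
    ∃ ρ : Measure (Set.Ioi (0 : ℝ)), IsProbabilityMeasure ρ ∧
      MeasurePreserving (fun p : ParamSphere M × Set.Ioi (0 : ℝ) =>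
        (p.2 : ℝ) • (p.1 : EuclideanSpace ℝ (Fin M)))
        ((sphereUniform M).prod ρ) (stdGaussian (EuclideanSpace ℝ (Fin M))) := by
  have := sphere_nontrivial hM
  have hP := isProbabilityMeasure_sphereUniform hM
  set E := EuclideanSpace ℝ (Fin M)
  set σ : Measure (ParamSphere M) := (volume : Measure E).toSphere with hσ
  have hσ0 : σ Set.univ ≠ 0 := by
    rw [Measure.measure_univ_ne_zero]; exact Measure.toSphere_ne_zero _
  have hσt : σ Set.univ ≠ ∞ := measure_ne_top _ _
  -- The Gaussian density depends on the norm alone; `q` is that radial profile, taken against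
  -- `r^(M-1) dr`.
  let q : ℝ → ℝ≥0∞ := fun r => ENNReal.ofReal
    (((2 * Real.pi) ^ ((Module.finrank ℝ E : ℝ) / 2))⁻¹ * Real.exp (-(r ^ 2 / 2)))
  have hq : Measurable q := by fun_prop
  have hq' : Measurable fun r : Set.Ioi (0 : ℝ) => q r := hq.comp measurable_subtype_coe
  set κ : Measure (Set.Ioi (0 : ℝ)) :=
    (Measure.volumeIoiPow (Module.finrank ℝ E - 1)).withDensity fun r => q r with hκ
  have hκs : SFinite κ := by infer_instance
  have hprod : (sphereUniform M).prod (σ Set.univ • κ) =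
      (σ.prod (Measure.volumeIoiPow (Module.finrank ℝ E - 1))).withDensity fun p => q p.2 := by
    rw [Measure.prod_smul_right, sphereUniform, Measure.prod_smul_left, smul_smul,
      ENNReal.mul_inv_cancel hσ0 hσt, one_smul, hκ, prod_withDensity_right hq']
  have hmeas : Measurable (fun p : ParamSphere M × Set.Ioi (0 : ℝ) => (p.2 : ℝ) • (p.1 : E)) := by
    fun_prop
  have hmp : MeasurePreserving (fun p : ParamSphere M × Set.Ioi (0 : ℝ) =>
      (p.2 : ℝ) • (p.1 : E)) ((sphereUniform M).prod (σ Set.univ • κ)) (stdGaussian E) := by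
    refine ⟨hmeas, Measure.ext_of_lintegral _ fun f hf => ?_⟩
    have hq2 : Measurable fun p : ParamSphere M × Set.Ioi (0 : ℝ) => q p.2 :=
      hq'.comp measurable_snd
    have hf2 : Measurable fun p : ParamSphere M × Set.Ioi (0 : ℝ) => f ((p.2 : ℝ) • (p.1 : E)) :=
      hf.comp hmeas
    -- The origin is a null set; removing it allows the polar homeomorphism to be used.
    rw [lintegral_map hf hmeas, hprod, stdGaussian_eq_withDensity,
      lintegral_withDensity_eq_lintegral_mul _ hq2 hf2,
      lintegral_withDensity_eq_lintegral_mul _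
        (continuous_stdGaussianPDF.measurable.ennreal_ofReal) hf,
      ← restrict_compl_singleton (μ := (volume : Measure E)) 0,
      ← lintegral_subtype_comap (measurableSet_singleton (0 : E)).compl,
      ← (Measure.measurePreserving_homeomorphUnitSphereProd (volume : Measure E)).lintegral_comp_emb
        (Homeomorph.measurableEmbedding _)]
    refine lintegral_congr fun x => ?_
    have hx : (x : E) ≠ 0 := x.2
    have hr : ‖(x : E)‖ ≠ 0 := norm_ne_zero_iff.2 hx
    have hfin : Module.finrank ℝ E = M := finrank_euclideanSpace_fin
    simp [q, stdGaussianPDF, smul_smul, mul_inv_cancel₀ hr, hfin]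
  refine ⟨σ Set.univ • κ, ⟨?_⟩, hmp⟩
  -- The radial mass needs no computation: the product and the sphere factor both have total mass
  -- `1`.
  have h1 := hmp.measure_preimage (s := Set.univ) MeasurableSet.univ.nullMeasurableSet
  rw [Set.preimage_univ, ← Set.univ_prod_univ, Measure.prod_prod, measure_univ (μ := sphereUniform M),
    one_mul, measure_univ (μ := stdGaussian E)] at h1
  exact h1

/-- The first absolute moment of a standard Gaussian variable. -/
noncomputable def gaussianAbsMoment : ℝ := ∫ x, |x| ∂(gaussianReal 0 1)

lemma integrable_abs_gaussianReal : Integrable (fun x : ℝ => |x|) (gaussianReal 0 1) :=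
  (IsGaussian.integrable_id (μ := gaussianReal 0 1)).abs

lemma gaussianAbsMoment_pos : 0 < gaussianAbsMoment := by
  have : NullSingletonClass (gaussianReal 0 1) := nullSingletonClass_gaussianReal one_ne_zero
  rw [gaussianAbsMoment, integral_pos_iff_support_of_nonneg (fun x => abs_nonneg x)
    integrable_abs_gaussianReal]
  have : Function.support (fun x : ℝ => |x|) = {0}ᶜ := by ext; simp
  rw [this, measure_compl (measurableSet_singleton _) (measure_ne_top _ _)]
  simp

lemma sum_abs_le_sqrt_mul_norm {M : ℕ} (v : EuclideanSpace ℝ (Fin M)) :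
    ∑ i, |v i| ≤ √(M : ℝ) * ‖v‖ := by
  rw [EuclideanSpace.norm_eq, ← Real.sqrt_mul (by positivity)]
  refine Real.le_sqrt_of_sq_le ?_
  have := sq_sum_le_card_mul_sum_sq (s := Finset.univ) (f := fun i => |v i|)
  simpa using this

/-- Taking means in `∑ |x i| ≤ √M ‖x‖` bounds the mean norm below by order `√M`; this is the source
of the factor `M` in Lévy's inequality. -/
lemma sqrt_mul_gaussianAbsMoment_le (M : ℕ) :
    √(M : ℝ) * gaussianAbsMoment ≤ ∫ x, ‖x‖ ∂(stdGaussian (EuclideanSpace ℝ (Fin M))) := by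
  set γ := stdGaussian (EuclideanSpace ℝ (Fin M)) with hγ
  have hco : ∀ i : Fin M, MeasurePreserving (fun x : EuclideanSpace ℝ (Fin M) => x i) γ
      (gaussianReal 0 1) := by
    intro i
    refine ⟨by fun_prop, ?_⟩
    rw [hγ, ← map_pi_eq_stdGaussian, Measure.map_map (by fun_prop) (by fun_prop)]
    exact (measurePreserving_eval (fun _ : Fin M => gaussianReal 0 1) i).map_eq
  have hint : ∀ i : Fin M, Integrable (fun x : EuclideanSpace ℝ (Fin M) => |x i|) γ := fun i =>
    (hco i).integrable_comp_of_integrable integrable_abs_gaussianReal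
  have hval : ∀ i : Fin M, ∫ x, |x i| ∂γ = gaussianAbsMoment := by
    intro i
    rw [gaussianAbsMoment, ← (hco i).map_eq, integral_map (by fun_prop) (by fun_prop)]
  have hn : Integrable (fun x : EuclideanSpace ℝ (Fin M) => ‖x‖) γ :=
    (IsGaussian.integrable_id (μ := γ)).norm
  have h1 : (M : ℝ) * gaussianAbsMoment ≤ √(M : ℝ) * ∫ x, ‖x‖ ∂γ := by
    rw [← integral_const_mul]
    calc _ = ∫ x, ∑ i, |x i| ∂γ := by
          rw [integral_finsetSum _ fun i _ => hint i]; simp [hval]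
      _ ≤ _ := integral_mono (integrable_finsetSum _ fun i _ => hint i) (hn.const_mul _)
          sum_abs_le_sqrt_mul_norm
  rcases Nat.eq_zero_or_pos M with rfl | hM
  · simpa using integral_nonneg fun x => norm_nonneg x
  · have hs : 0 < √(M : ℝ) := by positivity
    refine le_of_mul_le_mul_left ?_ hs
    rwa [← mul_assoc, Real.mul_self_sqrt (by positivity)]

/-- The positively homogeneous extension of a function on the sphere. -/
noncomputable def radialExtension {M : ℕ} (f : ParamSphere M → ℝ)
    (x : EuclideanSpace ℝ (Fin M)) : ℝ :=
  -- The default value is reached only at `x = 0`, where the factor `‖x‖` vanishes anyway.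
  ‖x‖ * Function.extend Subtype.val f 0 (‖x‖⁻¹ • x)

lemma radialExtension_smul {M : ℕ} (f : ParamSphere M → ℝ) (θ : ParamSphere M) {r : ℝ}
    (hr : 0 < r) : radialExtension f (r • (θ : EuclideanSpace ℝ (Fin M))) = r * f θ := by
  have hθ : ‖(θ : EuclideanSpace ℝ (Fin M))‖ = 1 := by simp
  have hn : ‖r • (θ : EuclideanSpace ℝ (Fin M))‖ = r := by
    rw [norm_smul, hθ, Real.norm_of_nonneg hr.le, mul_one]
  rw [radialExtension, hn, smul_smul, inv_mul_cancel₀ hr.ne', one_smul,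
    Subtype.val_injective.extend_apply]

lemma exists_smul_sphere {M : ℕ} {x : EuclideanSpace ℝ (Fin M)} (hx : x ≠ 0) :
    ∃ θ : ParamSphere M, x = ‖x‖ • (θ : EuclideanSpace ℝ (Fin M)) := by
  have h : ‖x‖ ≠ 0 := norm_ne_zero_iff.2 hx
  refine ⟨⟨‖x‖⁻¹ • x, ?_⟩, ?_⟩
  · simp [norm_smul, h]
  · simp [smul_smul, h]

/-- Half of the constant `4` comes from the change of norm, weighted by `|f| ≤ 2K`, and half from
the change of direction, since `‖y‖ ‖θ - η‖ ≤ 2 ‖x - y‖`. -/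
lemma lipschitzWith_radialExtension {M : ℕ} {f : ParamSphere M → ℝ} {K : ℝ≥0}
    (hf : LipschitzWith K f) (hb : ∀ θ, |f θ| ≤ 2 * K) :
    LipschitzWith (4 * K) (radialExtension f) := by
  refine LipschitzWith.of_dist_le_mul fun x y => ?_
  rw [Real.dist_eq, dist_eq_norm]
  push_cast
  have h0 : radialExtension f 0 = 0 := by simp [radialExtension]
  have hz : ∀ x : EuclideanSpace ℝ (Fin M), |radialExtension f x| ≤ 4 * K * ‖x‖ := by
    intro x
    by_cases hx : x = 0
    · simp [hx, h0]
    · obtain ⟨θ, hθ⟩ := exists_smul_sphere hx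
      have hr : 0 < ‖x‖ := norm_pos_iff.2 hx
      have e : radialExtension f x = ‖x‖ * f θ := by
        conv_lhs => rw [hθ]
        exact radialExtension_smul f θ hr
      rw [e, abs_mul, abs_norm]
      have := mul_le_mul_of_nonneg_left (hb θ) hr.le
      have hK : 0 ≤ (K : ℝ) * ‖x‖ := by positivity
      linarith
  by_cases hx : x = 0
  · simpa [hx, h0] using hz y
  by_cases hy : y = 0
  · simpa [hy, h0] using hz x
  obtain ⟨θ, hθ⟩ := exists_smul_sphere hx
  obtain ⟨η, hη⟩ := exists_smul_sphere hy
  have hr : 0 < ‖x‖ := norm_pos_iff.2 hx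
  have hs : 0 < ‖y‖ := norm_pos_iff.2 hy
  have ex : radialExtension f x = ‖x‖ * f θ := by
    conv_lhs => rw [hθ]
    exact radialExtension_smul f θ hr
  have ey : radialExtension f y = ‖y‖ * f η := by
    conv_lhs => rw [hη]
    exact radialExtension_smul f η hs
  have hd : |f θ - f η| ≤ K * ‖(θ : EuclideanSpace ℝ (Fin M)) - η‖ := by
    have := hf.dist_le_mul θ η
    rwa [Real.dist_eq, Subtype.dist_eq, dist_eq_norm] at this
  have hdir : ‖y‖ * ‖(θ : EuclideanSpace ℝ (Fin M)) - η‖ ≤ 2 * ‖x - y‖ := by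
    have e : ‖y‖ • ((θ : EuclideanSpace ℝ (Fin M)) - η) =
        (‖y‖ - ‖x‖) • (θ : EuclideanSpace ℝ (Fin M)) + (x - y) := by
      conv_rhs => rw [hη, hθ]
      simp only [norm_smul, norm_norm, norm_eq_of_mem_sphere, mul_one]
      module
    have h1 : ‖‖y‖ • ((θ : EuclideanSpace ℝ (Fin M)) - η)‖ =
        ‖y‖ * ‖(θ : EuclideanSpace ℝ (Fin M)) - η‖ := by rw [norm_smul, norm_norm]
    rw [← h1, e]
    refine (norm_add_le _ _).trans ?_
    rw [norm_smul, norm_eq_of_mem_sphere, mul_one, Real.norm_eq_abs]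
    have := abs_norm_sub_norm_le y x
    rw [norm_sub_rev] at this
    linarith
  have hn := abs_norm_sub_norm_le x y
  have e : radialExtension f x - radialExtension f y =
      (‖x‖ - ‖y‖) * f θ + ‖y‖ * (f θ - f η) := by rw [ex, ey]; ring
  rw [e]
  refine (abs_add_le _ _).trans ?_
  rw [abs_mul, abs_mul, abs_norm]
  have h1 : |‖x‖ - ‖y‖| * |f θ| ≤ ‖x - y‖ * (2 * K) := by
    gcongr
    exact hb θ
  have h2 : ‖y‖ * |f θ - f η| ≤ K * (2 * ‖x - y‖) := by
    calc _ ≤ ‖y‖ * (K * ‖(θ : EuclideanSpace ℝ (Fin M)) - η‖) := by gcongr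
      _ = K * (‖y‖ * ‖(θ : EuclideanSpace ℝ (Fin M)) - η‖) := by ring
      _ ≤ _ := by gcongr
  linarith

lemma integrable_of_continuous_sphere {M : ℕ} (hM : 1 ≤ M) {f : ParamSphere M → ℝ}
    (hf : Continuous f) : Integrable f (sphereUniform M) := by
  have := isProbabilityMeasure_sphereUniform hM
  obtain ⟨C, hC⟩ := isCompact_univ.exists_bound_of_continuousOn hf.continuousOn
  exact .of_bound hf.aestronglyMeasurable C (.of_forall fun x => hC x (Set.mem_univ _))

/-- A centred `f` satisfies `f θ = ∫ (f θ - f η)`, and the sphere has diameter at most `2`. -/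
lemma abs_le_of_integral_sphere_eq_zero {M : ℕ} (hM : 1 ≤ M) {f : ParamSphere M → ℝ} {K : ℝ≥0}
    (hf : LipschitzWith K f) (h0 : ∫ θ, f θ ∂(sphereUniform M) = 0) (θ : ParamSphere M) :
    |f θ| ≤ 2 * K := by
  have := isProbabilityMeasure_sphereUniform hM
  have hfi := integrable_of_continuous_sphere hM hf.continuous
  have e : f θ = ∫ η, (f θ - f η) ∂(sphereUniform M) := by
    rw [integral_sub (integrable_const _) hfi, h0]; simp
  rw [e, ← Real.norm_eq_abs]
  refine (norm_integral_le_of_norm_le_const (C := 2 * K) (.of_forall fun η => ?_)).trans (by simp)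
  have h1 := hf.dist_le_mul θ η
  rw [Real.dist_eq, Subtype.dist_eq, dist_eq_norm] at h1
  rw [Real.norm_eq_abs]
  refine h1.trans ?_
  have h2 : ‖(θ : EuclideanSpace ℝ (Fin M)) - η‖ ≤ 1 + 1 :=
    (norm_sub_le _ _).trans (by simp)
  calc (K : ℝ) * ‖(θ : EuclideanSpace ℝ (Fin M)) - η‖ ≤ K * (1 + 1) := by gcongr
    _ = 2 * K := by ring

/-- A centred Lipschitz function on the sphere is sub-Gaussian with the dimensional constant. -/
lemma hasSubgaussianMGF_sphere {M : ℕ} (hM : 1 ≤ M) {f : ParamSphere M → ℝ} {K : ℝ≥0}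
    (hf : LipschitzWith K f) (h0 : ∫ θ, f θ ∂(sphereUniform M) = 0) {c : ℝ≥0}
    (hc : (c : ℝ) = 4 * Real.pi ^ 2 * K ^ 2 / (M * gaussianAbsMoment ^ 2)) :
    HasSubgaussianMGF f c (sphereUniform M) := by
  have := isProbabilityMeasure_sphereUniform hM
  obtain ⟨ρ, hρ, hmp⟩ := exists_measurePreserving_polar_stdGaussian hM
  set γ := stdGaussian (EuclideanSpace ℝ (Fin M))
  have hfc := hf.continuous
  have hM0 : (0 : ℝ) < M := by exact_mod_cast hM
  have ha := gaussianAbsMoment_pos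
  have hL := lipschitzWith_radialExtension hf (abs_le_of_integral_sphere_eq_zero hM hf h0)
  have hLc := hL.continuous
  have hnorm : ∀ p : ParamSphere M × Set.Ioi (0 : ℝ),
      ‖(p.2 : ℝ) • (p.1 : EuclideanSpace ℝ (Fin M))‖ = p.2 := by
    intro p
    have : 0 < (p.2 : ℝ) := p.2.2
    rw [norm_smul, norm_eq_of_mem_sphere, mul_one, Real.norm_of_nonneg this.le]
  have hF : ∀ p : ParamSphere M × Set.Ioi (0 : ℝ),
      radialExtension f ((p.2 : ℝ) • (p.1 : EuclideanSpace ℝ (Fin M))) = p.2 * f p.1 :=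
    fun p => radialExtension_smul f p.1 p.2.2
  have hmpint : ∀ g : EuclideanSpace ℝ (Fin M) → ℝ, Continuous g →
      ∫ x, g x ∂γ = ∫ p, g ((p.2 : ℝ) • (p.1 : EuclideanSpace ℝ (Fin M)))
        ∂((sphereUniform M).prod ρ) := by
    intro g hg
    rw [← hmp.map_eq, integral_map hmp.measurable.aemeasurable hg.aestronglyMeasurable]
  have hsnd : MeasurePreserving (Prod.snd : ParamSphere M × Set.Ioi (0 : ℝ) → _)
      ((sphereUniform M).prod ρ) ρ := measurePreserving_snd
  have hrad : ∀ g : ℝ → ℝ, Continuous g → Integrable (fun x => g ‖x‖) γ →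
      Integrable (fun r : Set.Ioi (0 : ℝ) => g r) ρ := by
    intro g hg hi
    have h1 := hmp.integrable_comp_of_integrable hi
    refine (hsnd.integrable_comp (Continuous.aestronglyMeasurable (by fun_prop))).1 ?_
    refine h1.congr (.of_forall fun p => ?_)
    simp only [Function.comp_apply, hnorm]
  have hid : Integrable (fun r : Set.Ioi (0 : ℝ) => (r : ℝ)) ρ :=
    hrad (fun r => r) continuous_id (IsGaussian.integrable_id (μ := γ)).norm
  have hexp : ∀ a : ℝ, Integrable (fun r : Set.Ioi (0 : ℝ) => Real.exp (a * r)) ρ := fun a =>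
    hrad (fun r => Real.exp (a * r)) (by fun_prop) (integrable_exp_mul_norm_stdGaussian a)
  set m : ℝ := ∫ r : Set.Ioi (0 : ℝ), (r : ℝ) ∂ρ with hm
  have hmγ : ∫ x, ‖x‖ ∂γ = m := by
    rw [hmpint _ continuous_norm]
    simp_rw [hnorm]
    rw [hm]
    conv_rhs => rw [← hsnd.map_eq]
    rw [integral_map hsnd.measurable.aemeasurable
      (by rw [hsnd.map_eq]; exact hid.1)]
  have hmM : √(M : ℝ) * gaussianAbsMoment ≤ m := hmγ ▸ sqrt_mul_gaussianAbsMoment_le M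
  have hm0 : 0 < m := lt_of_lt_of_le (by positivity) hmM
  have hF0 : ∫ x, radialExtension f x ∂γ = 0 := by
    rw [hmpint _ hLc]
    simp_rw [hF]
    have := integral_prod_mul (μ := sphereUniform M) (ν := ρ) f (fun r : Set.Ioi (0 : ℝ) => (r : ℝ))
    rw [h0, zero_mul] at this
    simpa only [mul_comm] using this
  have hbound : ∀ t, Integrable (fun θ => Real.exp (t * f θ)) (sphereUniform M) := fun t =>
    integrable_of_continuous_sphere hM (by fun_prop)
  -- Jensen in the radius, by integrating the tangent line of `exp` at `s * m * a`.
  have hjen : ∀ s a : ℝ, Real.exp (s * m * a) ≤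
      ∫ r : Set.Ioi (0 : ℝ), Real.exp (s * (r * a)) ∂ρ := by
    intro s a
    have hi : Integrable (fun r : Set.Ioi (0 : ℝ) =>
        Real.exp (s * m * a) * (s * a * (r - m) + 1)) ρ :=
      (((hid.sub (integrable_const m)).const_mul (s * a)).add (integrable_const 1)).const_mul _
    calc Real.exp (s * m * a)
        = ∫ r : Set.Ioi (0 : ℝ), Real.exp (s * m * a) * (s * a * (r - m) + 1) ∂ρ := by
          rw [integral_const_mul, integral_add (by fun_prop) (integrable_const _),
            integral_const_mul, integral_sub hid (integrable_const _), ← hm]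
          simp
      _ ≤ _ := by
          refine integral_mono hi ((hexp (s * a)).congr (.of_forall fun r => ?_)) fun r => ?_
          · exact congrArg Real.exp (by ring)
          · have h1 := Real.add_one_le_exp (s * a * (r - m))
            have h2 := mul_le_mul_of_nonneg_left h1 (Real.exp_pos (s * m * a)).le
            rw [← Real.exp_add] at h2
            refine h2.trans (le_of_eq ?_)
            exact congrArg Real.exp (by ring)
  refine ⟨hbound, fun t => ?_⟩
  -- This choice makes the mean radius cancel: the exponent `s * r * f θ` averages to `t * f θ`.
  set s := t / m with hs
  have hst : s * m = t := by rw [hs]; field_simp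
  have hFi : Integrable (fun p : ParamSphere M × Set.Ioi (0 : ℝ) =>
      Real.exp (s * (p.2 * f p.1))) ((sphereUniform M).prod ρ) := by
    have := hmp.integrable_comp_of_integrable (integrable_exp_mul_lipschitz_stdGaussian hL s)
    refine this.congr (.of_forall fun p => ?_)
    simp only [Function.comp_apply, hF]
  calc mgf f (sphereUniform M) t = ∫ θ, Real.exp (s * m * f θ) ∂(sphereUniform M) := by
        rw [mgf, hst]
    _ ≤ ∫ θ, ∫ r : Set.Ioi (0 : ℝ), Real.exp (s * (r * f θ)) ∂ρ ∂(sphereUniform M) := by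
        refine integral_mono ?_ hFi.integral_prod_left fun θ => hjen s (f θ)
        rw [hst]; exact hbound t
    _ = ∫ x, Real.exp (s * radialExtension f x) ∂γ := by
        rw [hmpint _ (by fun_prop)]
        simp_rw [hF]
        rw [integral_prod _ hFi]
    _ ≤ Real.exp (s ^ 2 * (Real.pi / 2) ^ 2 * ((4 * K : ℝ≥0) : ℝ) ^ 2 / 2) :=
        integral_exp_lipschitz_stdGaussian_le hL hF0 s
    _ ≤ _ := by
        rw [Real.exp_le_exp, hc, hs]
        push_cast
        have hm2 : M * gaussianAbsMoment ^ 2 ≤ m ^ 2 := by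
          have := pow_le_pow_left₀ (by positivity) hmM 2
          rwa [mul_pow, Real.sq_sqrt hM0.le] at this
        calc (t / m) ^ 2 * (Real.pi / 2) ^ 2 * (4 * (K : ℝ)) ^ 2 / 2
            = 4 * Real.pi ^ 2 * K ^ 2 / m ^ 2 * t ^ 2 / 2 := by field_simp; ring
          _ ≤ _ := by gcongr

/-- **Lévy's concentration inequality** on the sphere. -/
theorem isLevyConstant_gaussianAbsMoment {M : ℕ} (hM : 1 ≤ M) :
    IsLevyConstant M (gaussianAbsMoment ^ 2 / (8 * Real.pi ^ 2)) := by
  intro K f hK hf τ hτ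
  have := isProbabilityMeasure_sphereUniform hM
  have hM0 : (0 : ℝ) < M := by exact_mod_cast hM
  have ha := gaussianAbsMoment_pos
  have hK' : (0 : ℝ) < K := hK
  set e := ∫ θ, f θ ∂(sphereUniform M) with he
  have hfi := integrable_of_continuous_sphere hM hf.continuous
  have hg : LipschitzWith K fun θ => f θ - e := by
    refine LipschitzWith.of_dist_le_mul fun x y => ?_
    rw [dist_sub_right]; exact hf.dist_le_mul x y
  have hg0 : ∫ θ, (f θ - e) ∂(sphereUniform M) = 0 := by
    rw [integral_sub hfi (integrable_const _), ← he]; simp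
  -- The variance proxy, giving tails `exp (-τ² / (2c))` on each side; hence the `8π²` in the Lévy
  -- constant.
  let c : ℝ≥0 := ⟨4 * Real.pi ^ 2 * K ^ 2 / (M * gaussianAbsMoment ^ 2), by positivity⟩
  have hsub := hasSubgaussianMGF_sphere hM hg hg0 (c := c) rfl
  have h1 := hsub.measure_ge_le hτ.le
  have h2 := hsub.neg.measure_ge_le hτ.le
  have hce : -τ ^ 2 / (2 * (c : ℝ)) =
      -(gaussianAbsMoment ^ 2 / (8 * Real.pi ^ 2) * (M * τ ^ 2 / (K : ℝ) ^ 2)) := by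
    change -τ ^ 2 / (2 * (4 * Real.pi ^ 2 * K ^ 2 / (M * gaussianAbsMoment ^ 2))) = _
    have := Real.pi_pos
    field_simp
    norm_num
  rw [hce] at h1 h2
  have hset : {θ | τ ≤ |f θ - e|} ⊆
      {θ | τ ≤ f θ - e} ∪ {θ | τ ≤ (-fun θ => f θ - e) θ} := by
    intro θ hθ
    simp only [Set.mem_union, Set.mem_ofPred_eq] at hθ ⊢
    exact le_abs.1 hθ
  rw [← ofReal_measureReal (measure_ne_top _ _)]
  refine ENNReal.ofReal_le_ofReal ?_
  refine (measureReal_mono hset).trans ((measureReal_union_le _ _).trans ?_)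
  linarith

end Sphere

/-! ### Positive semidefinite matrices. -/

section Matrices

open Matrix

variable {n : Type*} [Fintype n]

/-- In the order of `ℂ`, nonnegativity includes being real, and a complex matrix with real quadratic
form is Hermitian. -/
lemma Matrix.posSemidef_of_forall_dotProduct_mulVec_nonneg [DecidableEq n] {A : Matrix n n ℂ}
    (h : ∀ x, 0 ≤ star x ⬝ᵥ (A *ᵥ x)) : A.PosSemidef := by
  refine .of_dotProduct_mulVec_nonneg ?_ h
  rw [← isSymmetric_toEuclideanLin_iff, LinearMap.isSymmetric_iff_inner_map_self_real]
  intro v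
  have h1 := h v.ofLp
  rw [EuclideanSpace.inner_eq_star_dotProduct, toLpLin_apply]
  have h2 := (Complex.nonneg_iff.1 h1).2
  have e : v.ofLp ⬝ᵥ star (A *ᵥ v.ofLp) = star (star v.ofLp ⬝ᵥ (A *ᵥ v.ofLp)) := by
    rw [← star_dotProduct_star, star_star]
    exact dotProduct_comm _ _
  change star (v.ofLp ⬝ᵥ star (A *ᵥ v.ofLp)) = v.ofLp ⬝ᵥ star (A *ᵥ v.ofLp)
  rw [e, star_star]
  apply Complex.ext
  · simp
  · simp [← h2]

lemma Matrix.PosSemidef.trace_mul_nonneg [DecidableEq n] {A B : Matrix n n ℂ} (hA : A.PosSemidef)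
    (hB : B.PosSemidef) : 0 ≤ (A * B).trace := by
  obtain ⟨S, rfl⟩ : ∃ S : Matrix n n ℂ, B = Sᴴ * S := by
    open scoped MatrixOrder in
    exact CStarAlgebra.nonneg_iff_eq_star_mul_self.1 (Matrix.nonneg_iff_posSemidef.2 hB)
  rw [← Matrix.mul_assoc, Matrix.trace_mul_comm, ← Matrix.mul_assoc]
  exact (hA.mul_mul_conjTranspose_same S).trace_nonneg

lemma Matrix.norm_star_dotProduct_le (v w : n → ℂ) :
    ‖star v ⬝ᵥ w‖ ≤ √(star v ⬝ᵥ v).re * √(star w ⬝ᵥ w).re := by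
  have h := norm_inner_le_norm (𝕜 := ℂ) (WithLp.toLp 2 v) (WithLp.toLp 2 w)
  have hn : ∀ u : n → ℂ, ‖WithLp.toLp 2 u‖ = √(star u ⬝ᵥ u).re := by
    intro u
    rw [norm_eq_sqrt_re_inner (𝕜 := ℂ), EuclideanSpace.inner_eq_star_dotProduct, dotProduct_comm]
    rfl
  rwa [hn, hn, EuclideanSpace.inner_eq_star_dotProduct, dotProduct_comm] at h

lemma Matrix.posSemidef_one_sub_sq [DecidableEq n] {B : Matrix n n ℂ} (h1 : (1 - B).PosSemidef)
    (h2 : (1 + B).PosSemidef) : (1 - B * B).PosSemidef := by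
  have e : 1 - B * B = (2⁻¹ : ℂ) • ((1 + B)ᴴ * (1 - B) * (1 + B) + (1 - B)ᴴ * (1 + B) * (1 - B)) := by
    rw [h1.1.eq, h2.1.eq]
    have : (1 + B) * (1 - B) * (1 + B) + (1 - B) * (1 + B) * (1 - B) =
        (2 : ℂ) • (1 - B * B) := by
      rw [two_smul]; noncomm_ring
    rw [this, smul_smul]; norm_num
  rw [e]
  refine Matrix.PosSemidef.smul (α := ℂ) ?_ (by norm_num [Complex.nonneg_iff])
  exact (h1.conjTranspose_mul_mul_same _).add (h2.conjTranspose_mul_mul_same _)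

end Matrices

/-! ### Trace norm duality and quantum channels. -/

section TraceNorm

open Matrix

variable {d : ℕ}

/-- The trace norm dominates the pairing with Hermitian contractions. -/
lemma norm_trace_mul_le_traceNorm {B : Matrix (Fin d) (Fin d) ℂ} (h1 : (1 - B).PosSemidef)
    (h2 : (1 + B).PosSemidef) (Y : Matrix (Fin d) (Fin d) ℂ) :
    ‖(B * Y).trace‖ ≤ traceNorm Y := by
  have hB : Bᴴ = B := by
    have := h2.1.eq
    rwa [conjTranspose_add, conjTranspose_one, add_right_inj] at this
  set H := isHermitian_conjTranspose_mul_self Y with hH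
  set U : Matrix (Fin d) (Fin d) ℂ := H.eigenvectorUnitary.1 with hU
  have hUU : U * star U = 1 := Unitary.coe_mul_star_self _
  have htr : (B * Y).trace = (star U * (B * Y) * U).trace := by
    rw [trace_mul_comm (star U * (B * Y)) U, ← Matrix.mul_assoc, hUU, Matrix.one_mul]
  rw [htr, trace, traceNorm]
  refine (norm_sum_le _ _).trans (Finset.sum_le_sum fun i _ => ?_)
  set v : Fin d → ℂ := ⇑(H.eigenvectorBasis i) with hv
  have hent : (star U * (B * Y) * U).diag i = star v ⬝ᵥ ((B * Y) *ᵥ v) := by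
    rw [Matrix.mul_assoc, diag_apply, Matrix.mul_apply]
    rfl
  have hvv : star v ⬝ᵥ v = 1 := by
    have := H.eigenvectorBasis.orthonormal.1 i
    have h3 := inner_self_eq_norm_sq_to_K (𝕜 := ℂ) (H.eigenvectorBasis i)
    rw [this, EuclideanSpace.inner_eq_star_dotProduct, dotProduct_comm] at h3
    simpa using h3
  rw [hent]
  -- Since `v` is a unit vector and `B * B ≤ 1`, `|⟨v, B Y v⟩| ≤ ‖B Y v‖ ≤ ‖Y v‖`, and `‖Y v‖²` is
  -- the eigenvalue of `Yᴴ * Y` at `v`.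
  refine (norm_star_dotProduct_le _ _).trans ?_
  rw [hvv, Complex.one_re, Real.sqrt_one, one_mul]
  refine Real.sqrt_le_sqrt ?_
  rw [H.eigenvalues_eq i, ← hv]
  have h3 := (posSemidef_one_sub_sq h1 h2).re_dotProduct_nonneg (Y *ᵥ v)
  have e1 : star (Y *ᵥ v) ⬝ᵥ ((1 - B * B) *ᵥ (Y *ᵥ v)) =
      star v ⬝ᵥ ((Yᴴ * Y) *ᵥ v) - star ((B * Y) *ᵥ v) ⬝ᵥ ((B * Y) *ᵥ v) := by
    rw [sub_mulVec, one_mulVec, dotProduct_sub]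
    congr 1
    · rw [star_mulVec, ← dotProduct_mulVec, mulVec_mulVec]
    · rw [← mulVec_mulVec, ← mulVec_mulVec, star_mulVec B, hB, ← dotProduct_mulVec]
  rw [e1, map_sub, sub_nonneg] at h3
  exact h3

/-- The trace norm of a positive semidefinite matrix is its trace. -/
lemma traceNorm_eq_trace {A : Matrix (Fin d) (Fin d) ℂ} (hA : A.PosSemidef) :
    traceNorm A = A.trace.re := by
  -- The eigenvalues of `Aᴴ * A` and the squares of those of `A` are matched as multisets of roots,
  -- which avoids aligning their indexings.
  have h1 := (isHermitian_conjTranspose_mul_self A).roots_charpoly_eq_eigenvalues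
  have h2 : (Aᴴ * A).charpoly.roots =
      Multiset.map (fun i => ((hA.1.eigenvalues i ^ 2 : ℝ) : ℂ)) Finset.univ.val := by
    have e : (Aᴴ * A).charpoly =
        ∏ i, (Polynomial.X - Polynomial.C ((hA.1.eigenvalues i ^ 2 : ℝ) : ℂ)) := by
      rw [hA.1.eq]
      conv_lhs => rw [hA.1.spectral_theorem, ← map_mul, Unitary.conjStarAlgAut_apply,
        charpoly_mul_comm, ← Matrix.mul_assoc]
      simp [charpoly_diagonal, sq]
    rw [e, Polynomial.roots_prod]
    · simp [-Complex.ofReal_pow, -map_pow]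
    · simp [-Complex.ofReal_pow, -map_pow, Finset.prod_ne_zero_iff, Polynomial.X_sub_C_ne_zero]
  have h3 : (Multiset.map (fun z : ℂ => √z.re) (Aᴴ * A).charpoly.roots).sum = traceNorm A := by
    rw [h1, Multiset.map_map, traceNorm]; rfl
  rw [← h3, h2, Multiset.map_map, hA.1.trace_eq_sum_eigenvalues, Complex.re_sum]
  refine Finset.sum_congr rfl fun i _ => ?_
  simp [-Complex.ofReal_pow, Real.sqrt_sq (hA.eigenvalues_nonneg i)]

/-- Plain positivity is the case of `1 × 1` blocks. -/
lemma posSemidef_apply_of_isCPTP {T : Superop d} (hT : IsCPTP T) {A : Matrix (Fin d) (Fin d) ℂ}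
    (hA : A.PosSemidef) : (T A).PosSemidef := by
  have h := hT.completelyPositive 1 _ (hA.submatrix (Prod.snd : Fin 1 × Fin d → Fin d))
  exact h.submatrix fun i => ((0 : Fin 1), i)

lemma isState_apply_of_isCPTP {T : Superop d} (hT : IsCPTP T) {ρ : Matrix (Fin d) (Fin d) ℂ}
    (hρ : IsState ρ) : IsState (T ρ) :=
  ⟨posSemidef_apply_of_isCPTP hT hρ.1, by rw [hT.tracePreserving, hρ.2]⟩

/-- Observables bounded by one, evolved by a quantum channel, pair with matrices in a way
controlled by the trace norm. -/
lemma norm_trace_mul_apply_le_traceNorm {T : Superop d} (hT : IsCPTP T)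
    {B : Matrix (Fin d) (Fin d) ℂ} (h1 : (1 - B).PosSemidef) (h2 : (1 + B).PosSemidef)
    (Y : Matrix (Fin d) (Fin d) ℂ) : ‖(B * T Y).trace‖ ≤ traceNorm Y := by
  -- `D` is the Heisenberg-picture image of `B`, read off on matrix units. Positivity and trace
  -- preservation of `T`, tested on rank-one matrices, give `-1 ≤ D ≤ 1`.
  let D : Matrix (Fin d) (Fin d) ℂ := of fun b a => (B * T (single a b 1)).trace
  have hD : ∀ Z, (D * Z).trace = (B * T Z).trace := by
    intro Z
    conv_rhs => rw [matrix_eq_sum_single Z]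
    simp only [map_sum, Finset.mul_sum, trace_sum]
    rw [Finset.sum_comm]
    simp only [trace, diag_apply, Matrix.mul_apply, D, of_apply]
    refine Finset.sum_congr rfl fun b _ => Finset.sum_congr rfl fun a _ => ?_
    have : single a b (Z a b) = Z a b • single a b (1 : ℂ) := by simp [smul_single]
    rw [this, map_smul]
    simp only [Matrix.smul_apply, smul_eq_mul, Finset.sum_mul]
    refine Finset.sum_congr rfl fun i _ => Finset.sum_congr rfl fun j _ => ?_
    ring
  have hform : ∀ x : Fin d → ℂ,
      star x ⬝ᵥ (D *ᵥ x) = (B * T (vecMulVec x (star x))).trace ∧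
      star x ⬝ᵥ x = (T (vecMulVec x (star x))).trace := by
    intro x
    constructor
    · rw [← hD, mul_vecMulVec, trace_vecMulVec, dotProduct_comm]
    · rw [hT.tracePreserving, trace_vecMulVec, dotProduct_comm]
  have hP : ∀ x : Fin d → ℂ, (T (vecMulVec x (star x))).PosSemidef := fun x =>
    posSemidef_apply_of_isCPTP hT (posSemidef_vecMulVec_self_star x)
  rw [← hD]
  refine norm_trace_mul_le_traceNorm ?_ ?_ Y
  · refine posSemidef_of_forall_dotProduct_mulVec_nonneg fun x => ?_
    rw [sub_mulVec, one_mulVec, dotProduct_sub, (hform x).1, (hform x).2, ← trace_sub]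
    have := h1.trace_mul_nonneg (hP x)
    rwa [Matrix.sub_mul, Matrix.one_mul] at this
  · refine posSemidef_of_forall_dotProduct_mulVec_nonneg fun x => ?_
    rw [add_mulVec, one_mulVec, dotProduct_add, (hform x).1, (hform x).2, ← trace_add]
    have := h2.trace_mul_nonneg (hP x)
    rwa [Matrix.add_mul, Matrix.one_mul] at this

lemma traceNorm_apply_state_le {G : Superop d} {C : ℝ} (hC : 0 ≤ C)
    (hG : inducedNorm G ≤ ENNReal.ofReal C) {σ : Matrix (Fin d) (Fin d) ℂ} (hσ : IsState σ) :
    traceNorm (G σ) ≤ C := by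
  have h1 : traceNorm σ = 1 := by rw [traceNorm_eq_trace hσ.1, hσ.2, Complex.one_re]
  have h0 : σ ≠ 0 := by
    rintro rfl
    simpa using hσ.2
  have h2 : ENNReal.ofReal (traceNorm (G σ) / traceNorm σ) ≤ ENNReal.ofReal C :=
    (le_iSup₂ (f := fun (X : Matrix (Fin d) (Fin d) ℂ) (_ : X ≠ 0) =>
      ENNReal.ofReal (traceNorm (G X) / traceNorm X)) σ h0).trans hG
  rwa [ENNReal.ofReal_le_ofReal_iff hC, h1, div_one] at h2

end TraceNorm

/-! ### Duhamel's formula for superoperators. -/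

section Duhamel

lemma hasDerivAt_exp_mul_exp {𝔸 : Type*} [NormedRing 𝔸] [NormedAlgebra ℝ 𝔸] [CompleteSpace 𝔸]
    (A B : 𝔸) (t s : ℝ) :
    HasDerivAt (fun s : ℝ => NormedSpace.exp ((t - s) • A) * NormedSpace.exp (s • B))
      (NormedSpace.exp ((t - s) • A) * (B - A) * NormedSpace.exp (s • B)) s := by
  have h1 : HasDerivAt (fun s : ℝ => NormedSpace.exp ((t - s) • A))
      ((-1 : ℝ) • (NormedSpace.exp ((t - s) • A) * A)) s :=
    (hasDerivAt_exp_smul_const A (t - s)).scomp s ((hasDerivAt_id s).const_sub t)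
  have h2 := hasDerivAt_exp_smul_const' (𝕂 := ℝ) B s
  refine (h1.mul h2).congr_deriv ?_
  simp only [mul_sub, sub_mul, mul_assoc, neg_mul, neg_smul, one_smul]
  abel

open Matrix
open scoped Matrix.Norms.Operator

variable {d : ℕ}

lemma continuous_matrixExp (N : Type*) [Fintype N] [DecidableEq N] :
    Continuous (NormedSpace.exp : Matrix N N ℂ → Matrix N N ℂ) :=
  NormedSpace.exp_continuous

/-- Duhamel's formula in the form of a mean value inequality: the difference of two exponentials
is controlled by the derivative along the interpolation between them. -/
lemma abs_apply_superExp_sub_le (Λ : Superop d →ₗ[ℝ] ℝ) (L L' : Superop d) {t C : ℝ} (ht : 0 ≤ t)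
    (hC : ∀ s, 0 ≤ s → s ≤ t →
      |Λ (superExp ((t - s) • L) * (L' - L) * superExp (s • L'))| ≤ C) :
    |Λ (superExp (t • L')) - Λ (superExp (t • L))| ≤ C * t := by
  -- The calculus is done in the matrix algebra, where a norm is available; the derivative is then
  -- carried back to superoperators.
  set e := superMatrix d
  let Φ : Matrix (Fin d × Fin d) (Fin d × Fin d) ℂ →ₗ[ℝ] ℝ :=
    Λ ∘ₗ (e.symm.toLinearMap.restrictScalars ℝ)
  have hΦc : Continuous Φ := Φ.continuous_of_finiteDimensional
  have hsm : ∀ (s : ℝ) (T : Superop d), e (s • T) = s • e T := fun s T =>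
    (e.toLinearMap.restrictScalars ℝ).map_smul s T
  have hd : ∀ s : ℝ, HasDerivAt (fun s : ℝ =>
      Φ (NormedSpace.exp ((t - s) • e L) * NormedSpace.exp (s • e L')))
      (Φ (NormedSpace.exp ((t - s) • e L) * (e L' - e L) * NormedSpace.exp (s • e L'))) s := by
    intro s
    exact (⟨Φ, hΦc⟩ : _ →L[ℝ] ℝ).hasFDerivAt.comp_hasDerivAt s
      (hasDerivAt_exp_mul_exp (e L) (e L') t s)
  have hbound : ∀ s ∈ Set.Icc (0 : ℝ) t,
      ‖Φ (NormedSpace.exp ((t - s) • e L) * (e L' - e L) * NormedSpace.exp (s • e L'))‖ ≤ C := by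
    intro s hs
    have := hC s hs.1 hs.2
    rw [Real.norm_eq_abs]
    convert this using 2
    refine congrArg Λ ?_
    change e.symm _ = _
    rw [map_mul, map_mul, map_sub, e.symm_apply_apply, e.symm_apply_apply, ← hsm, ← hsm]
    rfl
  have h := (convex_Icc (0 : ℝ) t).norm_image_sub_le_of_norm_hasDerivWithin_le
    (fun s _ => (hd s).hasDerivWithinAt) hbound (Set.left_mem_Icc.2 ht) (Set.right_mem_Icc.2 ht)
  rw [Real.norm_eq_abs, Real.norm_eq_abs, sub_zero, abs_of_nonneg ht] at h
  convert h using 3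
  · rw [sub_self, zero_smul, NormedSpace.exp_zero, one_mul, ← hsm]
    rfl
  · rw [zero_smul, NormedSpace.exp_zero, mul_one, ← hsm]
    rfl

end Duhamel

/-! ### Lipschitz continuity and measurability of query expectations. -/

section Query

open Matrix

variable {d M : ℕ} {X : Type*} [Fintype X]

/-- The observable `∑ x, φ(x) E_x` of a statistical query. -/
noncomputable def queryObservable (E : X → Matrix (Fin d) (Fin d) ℂ) (φ : TestFn X) :
    Matrix (Fin d) (Fin d) ℂ :=
  ∑ x, ((φ x : ℝ) : ℂ) • E x

/-- The real functional `T ↦ Re Tr(B T(ρ))` on superoperators. -/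
noncomputable def expectationFunctional (B ρ : Matrix (Fin d) (Fin d) ℂ) :
    Superop d →ₗ[ℝ] ℝ where
  toFun T := ((B * T ρ).trace).re
  map_add' S T := by simp [Matrix.mul_add]
  map_smul' r T := by
    simp [Matrix.trace_smul]

lemma queryExp_eq_expectationFunctional (t : ℝ) (ρ : Matrix (Fin d) (Fin d) ℂ)
    (E : X → Matrix (Fin d) (Fin d) ℂ) (φ : TestFn X) (L : Superop d) :
    queryExp t ρ E φ L =
      expectationFunctional (queryObservable E φ) ρ (superExp (t • L)) := by
  simp [queryExp, outputProb, expectationFunctional, queryObservable, Matrix.sum_mul,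
    Matrix.trace_sum, Matrix.trace_smul]

lemma posSemidef_one_sub_queryObservable {E : X → Matrix (Fin d) (Fin d) ℂ} (hE : IsPOVM E)
    (φ : TestFn X) : (1 - queryObservable E φ).PosSemidef := by
  have e : 1 - queryObservable E φ = ∑ x, ((1 - (φ x : ℝ) : ℝ) : ℂ) • E x := by
    rw [← hE.sum_eq_one, queryObservable, ← Finset.sum_sub_distrib]
    simp [sub_smul]
  rw [e]
  refine posSemidef_sum _ fun x _ => (hE.posSemidef x).smul ?_
  have := (φ x).2.2
  exact_mod_cast sub_nonneg.2 this

lemma posSemidef_one_add_queryObservable {E : X → Matrix (Fin d) (Fin d) ℂ} (hE : IsPOVM E)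
    (φ : TestFn X) : (1 + queryObservable E φ).PosSemidef := by
  have e : 1 + queryObservable E φ = ∑ x, ((1 + (φ x : ℝ) : ℝ) : ℂ) • E x := by
    rw [← hE.sum_eq_one, queryObservable, ← Finset.sum_add_distrib]
    simp [add_smul]
  rw [e]
  refine posSemidef_sum _ fun x _ => (hE.posSemidef x).smul ?_
  have := (φ x).2.1
  have h : (0 : ℝ) ≤ 1 + (φ x : ℝ) := by linarith
  exact_mod_cast h

lemma lindbladFamily_sub (Lref : Superop d) (G : Fin M → Superop d) (δ : ℝ) (θ θ' : ParamSphere M) :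
    lindbladFamily Lref G δ θ' - lindbladFamily Lref G δ θ =
      (δ / √(M : ℝ)) • ∑ j, ((θ' : EuclideanSpace ℝ (Fin M)) - θ) j • G j := by
  have h : ∀ j, ((θ' : EuclideanSpace ℝ (Fin M)) - θ) j • G j =
      (θ' : EuclideanSpace ℝ (Fin M)) j • G j - (θ : EuclideanSpace ℝ (Fin M)) j • G j :=
    fun j => sub_smul (R := ℝ) (M := Superop d) ((θ' : EuclideanSpace ℝ (Fin M)) j)
      ((θ : EuclideanSpace ℝ (Fin M)) j) (G j)
  rw [lindbladFamily, lindbladFamily, add_sub_add_left_eq_sub, Finset.sum_congr rfl fun j _ => h j]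
  exact (smul_sub _ _ _).symm.trans (congrArg _ (Finset.sum_sub_distrib _ _).symm)

/-- Statistical query expectations are Lipschitz in the parameter of a family of Lindbladians. -/
theorem abs_queryExp_lindbladFamily_sub_le (hM : 1 ≤ M) {t : ℝ} (ht : 0 ≤ t)
    {ρ : Matrix (Fin d) (Fin d) ℂ} (hρ : IsState ρ)
    {E : X → Matrix (Fin d) (Fin d) ℂ} (hE : IsPOVM E) {Lref : Superop d}
    {G : Fin M → Superop d} {CG : ℝ} (hCG : 0 ≤ CG)
    (hG : ∀ j, inducedNorm (G j) ≤ ENNReal.ofReal CG) {δ : ℝ} (hδ : 0 ≤ δ) (φ : TestFn X)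
    {θ θ' : ParamSphere M} (hθ : IsGKSL (lindbladFamily Lref G δ θ))
    (hθ' : IsGKSL (lindbladFamily Lref G δ θ')) :
    |queryExp t ρ E φ (lindbladFamily Lref G δ θ) -
      queryExp t ρ E φ (lindbladFamily Lref G δ θ')| ≤
        t * δ * CG * ‖(θ : EuclideanSpace ℝ (Fin M)) - θ'‖ := by
  have hM0 : 0 < √(M : ℝ) := by
    have : (0 : ℝ) < M := by exact_mod_cast hM
    positivity
  set B := queryObservable E φ
  set Λ := expectationFunctional B ρ with hΛ
  set L := lindbladFamily Lref G δ θ with hL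
  set L' := lindbladFamily Lref G δ θ' with hL'
  rw [queryExp_eq_expectationFunctional, queryExp_eq_expectationFunctional]
  -- `ρ` evolves under `L` for time `s` and the observable under `L'` for time `t - s`, so only
  -- these two generators must be GKSL.
  have hmain := abs_apply_superExp_sub_le Λ L' L (t := t)
    (C := δ * CG * ‖(θ : EuclideanSpace ℝ (Fin M)) - θ'‖) ht ?_
  · refine hmain.trans (le_of_eq (by ring))
  intro s hs hst
  set S := superExp ((t - s) • L')
  have hS : IsCPTP S := hθ' (t - s) (by linarith)
  set σ := superExp (s • L) ρ
  have hσ : IsState σ := isState_apply_of_isCPTP (hθ s hs) hρ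
  have hj : ∀ j, |Λ (S * G j * superExp (s • L))| ≤ CG := by
    intro j
    have h1 := norm_trace_mul_apply_le_traceNorm hS
      (posSemidef_one_sub_queryObservable hE φ) (posSemidef_one_add_queryObservable hE φ) (G j σ)
    exact (Complex.abs_re_le_norm _).trans (h1.trans (traceNorm_apply_state_le hCG (hG j) hσ))
  set v : EuclideanSpace ℝ (Fin M) := (θ : EuclideanSpace ℝ (Fin M)) - θ' with hv
  have hexp : Λ (S * (L - L') * superExp (s • L)) =
      (δ / √(M : ℝ)) * ∑ j, v j * Λ (S * G j * superExp (s • L)) := by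
    rw [hL, hL', lindbladFamily_sub, ← hL]
    simp only [mul_smul_comm, smul_mul_assoc, Finset.mul_sum, Finset.sum_mul, map_smul, map_sum,
      smul_eq_mul, ← hv]
  rw [hexp, abs_mul, abs_of_nonneg (by positivity)]
  calc δ / √(M : ℝ) * |∑ j, v j * Λ (S * G j * superExp (s • L))|
      ≤ δ / √(M : ℝ) * ((√(M : ℝ) * ‖v‖) * CG) := by
        gcongr
        refine (Finset.abs_sum_le_sum_abs _ _).trans ?_
        refine le_trans ?_ (mul_le_mul_of_nonneg_right (sum_abs_le_sqrt_mul_norm v) hCG)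
        rw [Finset.sum_mul]
        refine Finset.sum_le_sum fun j _ => ?_
        rw [abs_mul]
        gcongr
        exact hj j
    _ = δ * CG * ‖v‖ := by field_simp

/-- The σ-algebra on superoperators is pulled back along `superMatrix`, so this factorization yields
measurability. -/
lemma exists_continuous_queryExp (t : ℝ) (ρ : Matrix (Fin d) (Fin d) ℂ)
    (E : X → Matrix (Fin d) (Fin d) ℂ) (φ : TestFn X) :
    ∃ g : Matrix (Fin d × Fin d) (Fin d × Fin d) ℂ → ℝ, Continuous g ∧
      queryExp t ρ E φ = g ∘ superMatrix d := by
  let Φ : Matrix (Fin d × Fin d) (Fin d × Fin d) ℂ →ₗ[ℝ] ℝ :=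
    expectationFunctional (queryObservable E φ) ρ ∘ₗ
      ((superMatrix d).symm.toLinearMap.restrictScalars ℝ)
  refine ⟨fun A => Φ (NormedSpace.exp (t • A)), ?_, ?_⟩
  · exact Φ.continuous_of_finiteDimensional.comp
      ((continuous_matrixExp _).comp (continuous_const_smul t))
  · funext L
    rw [queryExp_eq_expectationFunctional, superExp]
    have : superMatrix d (t • L) = t • superMatrix d L :=
      ((superMatrix d).toLinearMap.restrictScalars ℝ).map_smul t L
    rw [this]
    rfl

lemma measurable_queryExp (t : ℝ) (ρ : Matrix (Fin d) (Fin d) ℂ)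
    (E : X → Matrix (Fin d) (Fin d) ℂ) (φ : TestFn X) : Measurable (queryExp t ρ E φ) := by
  obtain ⟨g, hg, h⟩ := exists_continuous_queryExp t ρ E φ
  rw [h]
  let _ : MeasurableSpace (Matrix (Fin d × Fin d) (Fin d × Fin d) ℂ) := borel _
  have : BorelSpace (Matrix (Fin d × Fin d) (Fin d × Fin d) ℂ) := ⟨rfl⟩
  exact hg.measurable.comp (comap_measurable _)

lemma continuous_superMatrix_lindbladFamily (Lref : Superop d) (G : Fin M → Superop d) (δ : ℝ) :
    Continuous fun θ => superMatrix d (lindbladFamily Lref G δ θ) := by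
  have e : ∀ θ : ParamSphere M, superMatrix d (lindbladFamily Lref G δ θ) =
      superMatrix d Lref + (δ / √(M : ℝ)) •
        ∑ j, (θ : EuclideanSpace ℝ (Fin M)) j • superMatrix d (G j) := by
    intro θ
    let f := (superMatrix d).toLinearMap.restrictScalars ℝ
    change f _ = f _ + (δ / √(M : ℝ)) • ∑ j, (θ : EuclideanSpace ℝ (Fin M)) j • f (G j)
    simp only [lindbladFamily, map_add, map_smul, map_sum]
  simp_rw [e]
  fun_prop

lemma measurable_lindbladFamily (Lref : Superop d) (G : Fin M → Superop d) (δ : ℝ) :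
    Measurable (lindbladFamily Lref G δ) := by
  let _ : MeasurableSpace (Matrix (Fin d × Fin d) (Fin d × Fin d) ℂ) := borel _
  have : BorelSpace (Matrix (Fin d × Fin d) (Fin d × Fin d) ℂ) := ⟨rfl⟩
  exact measurable_comap_iff.2 (continuous_superMatrix_lindbladFamily Lref G δ).measurable

lemma continuous_queryExp_lindbladFamily (t : ℝ) (ρ : Matrix (Fin d) (Fin d) ℂ)
    (E : X → Matrix (Fin d) (Fin d) ℂ) (φ : TestFn X) (Lref : Superop d) (G : Fin M → Superop d)
    (δ : ℝ) : Continuous fun θ => queryExp t ρ E φ (lindbladFamily Lref G δ θ) := by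
  obtain ⟨g, hg, h⟩ := exists_continuous_queryExp t ρ E φ
  rw [h]
  exact hg.comp (continuous_superMatrix_lindbladFamily Lref G δ)

end Query

/-! ### Concentration of the random Lindbladian ensemble. -/

section Ensemble

variable {M : ℕ}

lemma paramMeasure_eq_sphereUniform (hM : 1 ≤ M) {Θ : Set (ParamSphere M)}
    (hΘ : ∀ᵐ θ ∂(sphereUniform M), θ ∈ Θ) : paramMeasure Θ = sphereUniform M := by
  have := isProbabilityMeasure_sphereUniform hM
  have h1 : sphereUniform M Θ = 1 := by
    exact (measure_congr (Filter.eventuallyEq_univ.2 hΘ)).trans measure_univ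
  rw [paramMeasure, h1, inv_one, one_smul, Measure.restrict_eq_self_of_ae_mem hΘ]

/-- Lévy's inequality for a function that is Lipschitz on a set of full measure only. -/
lemma sphereUniform_abs_sub_integral_ge_le {c : ℝ} (hc : IsLevyConstant M c)
    {Θ : Set (ParamSphere M)} (hΘ : ∀ᵐ θ ∂(sphereUniform M), θ ∈ Θ) {f : ParamSphere M → ℝ}
    {K : ℝ≥0} (hK : 0 < K) (hf : LipschitzOnWith K f Θ) {τ : ℝ} (hτ : 0 < τ) :
    sphereUniform M {θ | τ ≤ |f θ - ∫ θ', f θ' ∂(sphereUniform M)|} ≤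
      ENNReal.ofReal (2 * Real.exp (-(c * (M * τ ^ 2 / (K : ℝ) ^ 2)))) := by
  -- The extension keeps the constant `K` and agrees with `f` almost everywhere, so means and
  -- deviation probabilities are unchanged.
  obtain ⟨g, hg, hfg⟩ := hf.extend_real
  have hae : f =ᵐ[sphereUniform M] g := hΘ.mono fun θ hθ => hfg hθ
  rw [integral_congr_ae hae]
  refine le_trans (measure_mono_ae ?_) (hc K g hK hg τ hτ)
  filter_upwards [hae] with θ hθ h
  have h' : τ ≤ |f θ - ∫ θ', g θ' ∂(sphereUniform M)| := h
  rw [hθ] at h'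
  exact h'

end Ensemble

theorem mainTheorem1 :
    ∃ c : ℝ, 0 < c ∧ (∀ M : ℕ, 1 ≤ M → IsLevyConstant M c) ∧
      ∀ (d M : ℕ) (_ : 1 ≤ M) (X : Type*) [Fintype X]
        (t : ℝ) (_ : 0 < t)
        (ρ : Matrix (Fin d) (Fin d) ℂ) (_ : IsState ρ)
        (E : X → Matrix (Fin d) (Fin d) ℂ) (_ : IsPOVM E)
        (Lref : Superop d) (_ : IsGKSL Lref)
        (G : Fin M → Superop d) (CG : ℝ) (_ : 0 < CG)
        (_ : ∀ j, inducedNorm (G j) ≤ ENNReal.ofReal CG)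
        (δ : ℝ) (_ : 0 < δ)
        (Θ : Set (ParamSphere M)) (_ : ∀ θ ∈ Θ, IsGKSL (lindbladFamily Lref G δ θ)),
        (∀ φ : TestFn X, ∀ θ ∈ Θ, ∀ θ' ∈ Θ,
          |queryExp t ρ E φ (lindbladFamily Lref G δ θ) -
              queryExp t ρ E φ (lindbladFamily Lref G δ θ')| ≤
            t * δ * CG * ‖(θ : EuclideanSpace ℝ (Fin M)) - θ'‖) ∧
        ((∀ᵐ θ ∂(sphereUniform M), θ ∈ Θ) →
          IsProbabilityMeasure (lindbladEnsemble Lref G δ Θ) ∧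
          (∀ φ : TestFn X, Integrable (queryExp t ρ E φ) (lindbladEnsemble Lref G δ Θ) ∧
            meanQuery t ρ E (lindbladEnsemble Lref G δ Θ) φ =
              ∫ θ, queryExp t ρ E φ (lindbladFamily Lref G δ θ) ∂(paramMeasure Θ)) ∧
          ∀ τ : ℝ, 0 < τ →
            frac t ρ E (lindbladEnsemble Lref G δ Θ)
                (meanQuery t ρ E (lindbladEnsemble Lref G δ Θ)) τ ≤
              ENNReal.ofReal (2 * Real.exp (-(c * (M * τ ^ 2 / (t * δ * CG) ^ 2)))) ∧
            ∀ c' : ℝ, 0 < c' → IsLevyConstant M c' →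
              frac t ρ E (lindbladEnsemble Lref G δ Θ)
                  (meanQuery t ρ E (lindbladEnsemble Lref G δ Θ)) τ ≤
                ENNReal.ofReal (2 * Real.exp (-(c' * (M * τ ^ 2 / (t * δ * CG) ^ 2))))) := by
  have hcpos : 0 < gaussianAbsMoment ^ 2 / (8 * Real.pi ^ 2) := by
    have := gaussianAbsMoment_pos
    positivity
  refine ⟨gaussianAbsMoment ^ 2 / (8 * Real.pi ^ 2), hcpos,
    fun M hM => isLevyConstant_gaussianAbsMoment hM, ?_⟩
  intro d M hM X _ t ht ρ hρ E hE Lref _ G CG hCG hG δ hδ Θ hΘ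
  have hlip : ∀ φ : TestFn X, ∀ θ ∈ Θ, ∀ θ' ∈ Θ,
      |queryExp t ρ E φ (lindbladFamily Lref G δ θ) -
        queryExp t ρ E φ (lindbladFamily Lref G δ θ')| ≤
          t * δ * CG * ‖(θ : EuclideanSpace ℝ (Fin M)) - θ'‖ := fun φ θ hθ θ' hθ' =>
    abs_queryExp_lindbladFamily_sub_le hM ht.le hρ hE hCG.le hG hδ.le φ (hΘ θ hθ) (hΘ θ' hθ')
  refine ⟨hlip, fun hfull => ?_⟩
  have hμ := isProbabilityMeasure_sphereUniform hM
  have hens : lindbladEnsemble Lref G δ Θ =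
      (sphereUniform M).map (lindbladFamily Lref G δ) := by
    rw [lindbladEnsemble, paramMeasure_eq_sphereUniform hM hfull]
  have hmL := measurable_lindbladFamily (M := M) Lref G δ
  have hmean : ∀ φ : TestFn X, meanQuery t ρ E (lindbladEnsemble Lref G δ Θ) φ =
      ∫ θ, queryExp t ρ E φ (lindbladFamily Lref G δ θ) ∂(sphereUniform M) := by
    intro φ
    rw [meanQuery, hens, integral_map hmL.aemeasurable
      (measurable_queryExp t ρ E φ).aestronglyMeasurable]
  refine ⟨?_, fun φ => ⟨?_, ?_⟩, ?_⟩
  · rw [hens]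
    exact Measure.isProbabilityMeasure_map hmL.aemeasurable
  · rw [hens, integrable_map_measure (measurable_queryExp t ρ E φ).aestronglyMeasurable
      hmL.aemeasurable]
    exact integrable_of_continuous_sphere hM
      (continuous_queryExp_lindbladFamily t ρ E φ Lref G δ)
  · rw [hmean, paramMeasure_eq_sphereUniform hM hfull]
  · intro τ hτ
    have hfrac : ∀ c' : ℝ, IsLevyConstant M c' →
        frac t ρ E (lindbladEnsemble Lref G δ Θ)
          (meanQuery t ρ E (lindbladEnsemble Lref G δ Θ)) τ ≤
            ENNReal.ofReal (2 * Real.exp (-(c' * (M * τ ^ 2 / (t * δ * CG) ^ 2)))) := by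
      intro c' hc'
      refine iSup_le fun φ => ?_
      have hset : MeasurableSet {L : Superop d | τ ≤ |queryExp t ρ E φ L -
          meanQuery t ρ E (lindbladEnsemble Lref G δ Θ) φ|} :=
        measurableSet_le measurable_const
          (((measurable_queryExp t ρ E φ).sub_const _).norm)
      -- The ensemble also occurs inside `meanQuery`; it is folded back after the event is pulled
      -- back to the sphere, so that `hmean` applies.
      conv_lhs => rw [hens, Measure.map_apply hmL (by rw [← hens]; exact hset), ← hens, hmean]
      have hK : 0 < t * δ * CG := by positivity
      have hf : LipschitzOnWith ⟨t * δ * CG, hK.le⟩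
          (fun θ => queryExp t ρ E φ (lindbladFamily Lref G δ θ)) Θ := by
        refine LipschitzOnWith.of_dist_le_mul fun θ hθ θ' hθ' => ?_
        rw [Real.dist_eq, Subtype.dist_eq, dist_eq_norm]
        exact hlip φ θ hθ θ' hθ'
      exact sphereUniform_abs_sub_integral_ge_le hc' hfull (K := ⟨t * δ * CG, hK.le⟩) hK hf hτ
    exact ⟨hfrac _ (isLevyConstant_gaussianAbsMoment hM), fun c' _ hc' => hfrac c' hc'⟩
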